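/- **Setting.** Let $d,K,L\ge 1$ be integers, $\beta^*\in\mathbb R^d$ with support $\mathcal S=\{i:\beta^*_i\ne 0\}$, $s_0=|\mathcal S|\ge 1$. In each round $t=1,2,\dots$ a learner sees random features $X^t_1,\dots,X^t_K\in\mathbb R^d$, selects a set $\mathcal I_t\subset\{1,\dots,K\}$ of $L$ arms and observes the rewards $r_{t,k}=X_k^{t\top}\beta^*+\epsilon_{t,k}$ for $k\in\mathcal I_t$. Let $\mathcal F'_t$ be the $\sigma$-algebra generated by the features, the selected sets and the observed rewards of rounds $1,\dots,t$, and $\mathcal F_t$ the one generated by $\mathcal F'_{t-1}$, the features of round $t$ and $\mathcal I_t$. The noise is $\sigma$-sub-Gaussian, $\sigma>0$: $\mathbb E[\exp(\sum_k l_k\epsilon_{t,k})\mid\mathcal F_t]\le\exp(\sigma^2\sum_k l_k^2/2)$ for all $l\in\mathbb R^K$. Assume $\|X^t_k\|_\infty\le x_{\max}$ and $\|\beta^*\|_1\le b$. The greedy LASSO algorithm starts with $\hat\beta_0=0$, takes $$\hat\beta_t\in\operatorname*{argmin}_{\beta}\ \frac1{Lt}\sum_{s=1}^t\sum_{k\in\mathcal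 I_s}(r_{s,k}-X_k^{s\top}\beta)^2+\lambda_{Lt}\|\beta\|_1,\qquad \lambda_n=4x_{\max}\sigma\sqrt{\frac{4\log n+2\log d}{n}},$$ and selects as $\mathcal I_t$ a set of $L$ arms with the largest values of $X_k^{t\top}\hat\beta_{t-1}$ (ties broken arbitrarily, possibly at random). Its expected regret is $R(T)=\sum_{t=1}^T\mathbb E[r_t^*-r_t]$ with $r_t=\sum_{k\in\mathcal I_t}r_{t,k}$ and $r^*_t=\sum_{k\in\mathcal I^*_t}r_{t,k}$, where $\mathcal I_t^*$ (a function of the features of round $t$) maximizes $\sum_{k\in\mathcal I}X_k^{t\top}\beta^*$ over $|\mathcal I|=L$. Put $$\bar G_t=\frac1{Lt}\sum_{s=1}^t\mathbb E\Big[\sum_{k\in\mathcal I_s}X_k^sX_k^{s\top}\,\Big|\,\mathcal F'_{s-1}\Big],\qquad \phi_{\mathcal S}(\Sigma)=\min_{V\ne0,\ \|V\|_{\mathcal S^c,1}\le3\|V\|_{\mathcal S,1}}\sqrt{s_0\,\frac{V^\top\Sigma V}{\|V\|_{\mathcal S,1}^2}},$$ where $\|V\|_{\mathcal T,1}=\sum_{i\in\mathcal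 T}|V_i|$. **Corollary 2.** Let $T\ge1$ and $\bar\phi>0$, and suppose that almost surely $\min_{1\le t\le T}\phi_{\mathcal S}(\bar G_t)>\bar\phi$. Then, with $\kappa(\bar\phi)=\min\big(2-\sqrt2,\ \bar\phi^2/(256\,x_{\max}^2s_0)\big)$, $$R(T)\le 2Lx_{\max}b\left(\frac{1+\log(d(d+1))}{\kappa(\bar\phi)^2}+\frac{\pi^2}{3L^2}\right)+\frac{128\,s_0x_{\max}^2\sigma}{\bar\phi^2}\sqrt{L\,(4\log(LT)+2\log d)\,T}.$$ In particular $R(T)=O\big(\bar\phi^{-2}\sqrt{T\log(dT)}\big)$: there is a constant $C$ depending only on $x_{\max},b,\sigma,s_0,L$ such that for all $d$ and $\bar\phi>0$ there is $T_1$ with $R(T)\le C\bar\phi^{-2}\sqrt{T\log(dT)}$ for all $T\ge T_1$ and every such bandit for which almost surely $\min_{1\le t\le T}\phi_{\mathcal S}(\bar G_t)>\bar\phi$. -/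

import Mathlib

open MeasureTheory ProbabilityTheory
open scoped Matrix

noncomputable section

namespace SparseBandit

/-- The active set `S = {i | β i ≠ 0}` of a parameter vector. -/
def activeSet {d : ℕ} (β : Fin d → ℝ) : Finset (Fin d) :=
  Finset.univ.filter fun i => β i ≠ 0

/-- The partial `ℓ¹`-norm `‖v‖_{A,1} = ∑_{i ∈ A} |v i|`. -/
def l1On {d : ℕ} (A : Finset (Fin d)) (v : Fin d → ℝ) : ℝ :=
  ∑ i ∈ A, |v i|

/-- The `ℓ¹`-norm `‖v‖₁`. -/
def l1 {d : ℕ} (v : Fin d → ℝ) : ℝ :=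
  ∑ i, |v i|

/-- The compatibility constant
`φ_S(M) = min { √(|S| · vᵀ M v / ‖v‖_{S,1}²) : v ≠ 0, ‖v‖_{Sᶜ,1} ≤ 3 ‖v‖_{S,1} }`.
The vector `v = 0`, for which the quotient is `0 / 0`, does not take part; every other vector of
the cone has `‖v‖_{S,1} > 0`. -/
def compatConst {d : ℕ} (S : Finset (Fin d)) (M : Matrix (Fin d) (Fin d) ℝ) : ℝ :=
  sInf {c : ℝ | ∃ v : Fin d → ℝ, v ≠ 0 ∧ l1On Sᶜ v ≤ 3 * l1On S v ∧
    c = √((S.card : ℝ) * ((v ⬝ᵥ (M *ᵥ v)) / (l1On S v) ^ 2))}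

/-- The random quantities of a run of a combinatorial linear bandit with `K` arms and features in
`ℝ^d`.  Rounds are numbered `1, 2, 3, …`. -/
structure Run (Ω : Type*) (K d : ℕ) where
  /-- `X t ω k` is the feature vector of arm `k` in round `t`. -/
  X : ℕ → Ω → Fin K → Fin d → ℝ
  /-- `noise t ω k` is the noise of the reward of arm `k` in round `t`. -/
  noise : ℕ → Ω → Fin K → ℝ
  /-- `sel t ω` is the set of arms selected in round `t`. -/
  sel : ℕ → Ω → Finset (Fin K)
  /-- `est t ω` is the estimate of the parameter computed after round `t`. -/
  est : ℕ → Ω → Fin d → ℝ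

namespace Run

variable {Ω : Type*} {K d : ℕ}

/-- The reward `r_{t,k} = X_{t,k}ᵀ β + ε_{t,k}` of arm `k` in round `t`. -/
def reward (R : Run Ω K d) (β : Fin d → ℝ) (t : ℕ) (ω : Ω) (k : Fin K) : ℝ :=
  R.X t ω k ⬝ᵥ β + R.noise t ω k

/-- The rewards seen by the learner in round `t`: those of the selected arms (the entries of the
other arms are blanked by `0`). -/
def observed (R : Run Ω K d) (β : Fin d → ℝ) (t : ℕ) (ω : Ω) (k : Fin K) : ℝ :=
  if k ∈ R.sel t ω then R.reward β t ω k else 0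

/-- The σ-algebra generated by the features and the selected set of round `t`. -/
abbrev roundSigma (R : Run Ω K d) (t : ℕ) : MeasurableSpace Ω :=
  MeasurableSpace.comap (R.X t) inferInstance ⊔ MeasurableSpace.comap (R.sel t) ⊤

/-- The σ-algebra `ℱ'_t` generated by the features, the selected sets and the observed rewards of
the rounds `1, …, t`. -/
abbrev postSigma (R : Run Ω K d) (β : Fin d → ℝ) (t : ℕ) : MeasurableSpace Ω :=
  ⨆ s ∈ Finset.Icc 1 t, (R.roundSigma s ⊔ MeasurableSpace.comap (R.observed β s) inferInstance)

/-- The σ-algebra `ℱ_t` generated by everything observed in the rounds `1, …, t - 1` and by the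
features and the selected set of round `t`. -/
abbrev preSigma (R : Run Ω K d) (β : Fin d → ℝ) (t : ℕ) : MeasurableSpace Ω :=
  R.postSigma β (t - 1) ⊔ R.roundSigma t

/-- The expected Gram matrix
`Ḡ_t = 1/(L t) ∑_{s=1}^t 𝔼[∑_{k ∈ I_s} X_{s,k} X_{s,k}ᵀ | ℱ'_{s-1}]`, a random matrix. -/
def expectedGram [MeasurableSpace Ω] (R : Run Ω K d) (μ : Measure Ω) (β : Fin d → ℝ) (L t : ℕ)
    (ω : Ω) : Matrix (Fin d) (Fin d) ℝ :=
  Matrix.of fun i j => (1 / ((L : ℝ) * t)) * ∑ s ∈ Finset.Icc 1 t,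
    (μ[fun ω' => ∑ k ∈ R.sel s ω', R.X s ω' k i * R.X s ω' k j | R.postSigma β (s - 1)]) ω

/-- The LASSO objective after round `t`, over the `L t` observations made so far, with
regularization parameter `lam`. -/
def lassoObjective (R : Run Ω K d) (β : Fin d → ℝ) (L t : ℕ) (lam : ℝ) (ω : Ω)
    (v : Fin d → ℝ) : ℝ :=
  (1 / ((L : ℝ) * t)) * ∑ s ∈ Finset.Icc 1 t, ∑ k ∈ R.sel s ω,
    (R.reward β s ω k - R.X s ω k ⬝ᵥ v) ^ 2 + lam * l1 v

/-- The expected regret `∑_{t=1}^T 𝔼[r*_t - r_t]`, where `r_t` is the total reward of the selected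
arms and `r*_t` is the total reward of the arms in `opt t`. -/
def regret [MeasurableSpace Ω] (R : Run Ω K d) (μ : Measure Ω) (β : Fin d → ℝ)
    (opt : ℕ → Ω → Finset (Fin K)) (T : ℕ) : ℝ :=
  ∑ t ∈ Finset.Icc 1 T,
    ∫ ω, (∑ k ∈ opt t ω, R.reward β t ω k - ∑ k ∈ R.sel t ω, R.reward β t ω k) ∂μ

end Run

/-- `I` is a greedy (top-`L`) choice for the parameter `v` and the features `x`: it has `L`
elements, and no arm outside `I` has a larger score than an arm in `I`. -/
def IsGreedySet {K d : ℕ} (L : ℕ) (x : Fin K → Fin d → ℝ) (v : Fin d → ℝ)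
    (I : Finset (Fin K)) : Prop :=
  I.card = L ∧ ∀ i ∈ I, ∀ j ∉ I, x j ⬝ᵥ v ≤ x i ⬝ᵥ v

/-- `I` is an optimal set of `L` arms for the true parameter `β`: it maximizes the mean reward. -/
def IsOptimalSet {K d : ℕ} (L : ℕ) (x : Fin K → Fin d → ℝ) (β : Fin d → ℝ)
    (I : Finset (Fin K)) : Prop :=
  I.card = L ∧ ∀ J : Finset (Fin K), J.card = L → ∑ k ∈ J, x k ⬝ᵥ β ≤ ∑ k ∈ I, x k ⬝ᵥ β

/-- The regularization parameter
`λ_n = 4 x_max σ √((4 log n + 2 log d) / n)` for `n = L t` observations. -/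
def lassoLam (xmax σ : ℝ) (d L t : ℕ) : ℝ :=
  4 * xmax * σ * √((4 * Real.log ((L : ℝ) * t) + 2 * Real.log d) / ((L : ℝ) * t))

/-- `κ(φ) = min (2 - √2, φ² / (256 x_max² s₀))`. -/
def kappa (xmax : ℝ) (s₀ : ℕ) (φ : ℝ) : ℝ :=
  min (2 - √2) (φ ^ 2 / (256 * xmax ^ 2 * s₀))

/-- `R` is a run, over the rounds `1, …, T`, of the greedy LASSO algorithm in the combinatorial
linear bandit with parameter `β`, in which `L` arms are selected in each round.  The feature
process is arbitrary (bounded and measurable, for instance i.i.d. over the rounds), and ties of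
the greedy rule, or between minimizers of the LASSO objective, may be broken in any way (for
instance at random). -/
structure IsGreedyLassoRun {Ω : Type*} [MeasurableSpace Ω] {K d : ℕ} (μ : Measure Ω)
    (xmax σ : ℝ) (L T : ℕ) (β : Fin d → ℝ) (R : Run Ω K d) : Prop where
  measurable_X : ∀ t ∈ Finset.Icc 1 T, Measurable (R.X t)
  measurable_noise : ∀ t ∈ Finset.Icc 1 T, Measurable (R.noise t)
  measurableSet_sel : ∀ t ∈ Finset.Icc 1 T, ∀ J : Finset (Fin K), MeasurableSet {ω | R.sel t ω = J}
  /-- The features are bounded: `‖X_{t,k}‖_∞ ≤ x_max`. -/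
  bounded : ∀ t ∈ Finset.Icc 1 T, ∀ᵐ ω ∂μ, ∀ k i, |R.X t ω k i| ≤ xmax
  /-- Given `ℱ_t`, the noise of the single arms is jointly `σ`-sub-Gaussian:
  `𝔼[exp(∑_k l_k ε_{t,k}) | ℱ_t] ≤ exp(σ² ∑_k l_k² / 2)`.  This holds if the noises of the arms
  are conditionally independent and `σ`-sub-Gaussian given `ℱ_t`, and more generally if each of
  them is `σ`-sub-Gaussian conditionally on `ℱ_t` and on those of the arms before it. -/
  integrable_exp : ∀ t ∈ Finset.Icc 1 T, ∀ l : Fin K → ℝ,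
    Integrable (fun ω => Real.exp (∑ k, l k * R.noise t ω k)) μ
  subGaussian : ∀ t ∈ Finset.Icc 1 T, ∀ l : Fin K → ℝ, ∀ᵐ ω ∂μ,
    (μ[fun ω' => Real.exp (∑ k, l k * R.noise t ω' k) | R.preSigma β t]) ω
      ≤ Real.exp (σ ^ 2 * (∑ k, l k ^ 2) / 2)
  /-- The initial estimate is `0`. -/
  est_zero : ∀ᵐ ω ∂μ, R.est 0 ω = 0
  /-- After round `t`, the estimate minimizes the LASSO objective. -/
  est_lasso : ∀ t ∈ Finset.Icc 1 T, ∀ᵐ ω ∂μ, ∀ v : Fin d → ℝ,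
    R.lassoObjective β L t (lassoLam xmax σ d L t) ω (R.est t ω)
      ≤ R.lassoObjective β L t (lassoLam xmax σ d L t) ω v
  /-- The arms are selected greedily with respect to the last estimate. -/
  greedy : ∀ t ∈ Finset.Icc 1 T, ∀ᵐ ω ∂μ, IsGreedySet L (R.X t ω) (R.est (t - 1) ω) (R.sel t ω)

/-- `opt` is an optimal selection over the rounds `1, …, T`: the set `opt t` is a (measurable)
function of the features of round `t` and maximizes the mean reward. -/
structure IsOptimalSelection {Ω : Type*} [MeasurableSpace Ω] {K d : ℕ} (μ : Measure Ω)
    (L T : ℕ) (β : Fin d → ℝ) (R : Run Ω K d) (opt : ℕ → Ω → Finset (Fin K)) : Prop where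
  measurableSet_opt : ∀ t ∈ Finset.Icc 1 T, ∀ J : Finset (Fin K),
    MeasurableSet[MeasurableSpace.comap (R.X t) inferInstance] {ω | opt t ω = J}
  optimal : ∀ t ∈ Finset.Icc 1 T, ∀ᵐ ω ∂μ, IsOptimalSet L (R.X t ω) β (opt t ω)

end SparseBandit

end

/-!
The regret of a round is controlled by the `ℓ¹`-error of the preceding LASSO estimate: a greedy set
has the largest estimated score, so its mean regret is at most `2 L x_max ‖β̂ - β‖₁`
(`IsGreedySet.regret_le`).  The noise itself has conditional mean zero and drops out of the expected
regret (`integral_reward_sub_eq`).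

After round `n` the oracle inequality of the LASSO (`l1_lasso_error_le`) gives
`‖β̂ - β‖₁ ≤ 8 s₀ λ_{Ln} / φ²` unless one of two things happens.  Either the noise is not dominated
by the penalty, which has probability at most `2 / (L n)²` (`measure_noiseEvent_le`), or the
empirical Gram matrix differs from the expected one by at least `φ² / (32 s₀)` in some entry, which
has probability at most `2 d² exp (-8 κ² n)` (`measure_gramEvent_le`).  If the matrices are closer
than that, the compatibility constant `φ` of the expected Gram matrix leaves `φ / √2` for the
empirical one (`half_sq_mul_le_of_close`).  On the exceptional events the regret is bounded
trivially.  Summation over the rounds yields the three terms of the bound (`regret_le`).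

Both probabilities come from one Azuma–Hoeffding inequality (`measure_abs_sum_ge_le`) for
increments that are sub-Gaussian conditionally on the past.  For the Gram matrix this is Hoeffding's
lemma.  For the noise, the coefficients `X_{s,k}` are random, and the sub-Gaussian hypothesis, given
for constant coefficients, is extended to them by approximation with simple functions and Fatou's
lemma (`lintegral_mul_exp_random_coeff_le`).  Conditional exponential moments are tested against
nonnegative weights under the Lebesgue integral, which makes integrability a side issue and requires
no regular conditional probabilities.
-/

namespace SparseBandit

/-! ### Elementary sums -/

lemma sum_one_div_sqrt_le (T : ℕ) :
    ∑ n ∈ Finset.range T, 1 / √((n : ℝ) + 1) ≤ 2 * √(T : ℝ) := by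
  induction T with
  | zero => simp
  | succ n ih =>
    rw [Finset.sum_range_succ]
    have h1 : 0 < √((n : ℝ) + 1) := Real.sqrt_pos.2 (by positivity)
    have h2 : √((n : ℝ) + 1) ^ 2 = n + 1 := Real.sq_sqrt (by positivity)
    have h3 : √(n : ℝ) ^ 2 = n := Real.sq_sqrt (by positivity)
    have h4 : 1 / √((n : ℝ) + 1) ≤ 2 * √((n : ℝ) + 1) - 2 * √(n : ℝ) := by
      rw [div_le_iff₀ h1]
      nlinarith [sq_nonneg (√((n : ℝ) + 1) - √(n : ℝ))]
    push_cast
    linarith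

/-- The terms before `log N / a` are at most `1`, the later ones are dominated by a geometric
series. -/
lemma sum_min_one_exp_le {N a : ℝ} (hN : 1 ≤ N) (ha : 0 < a) (T : ℕ) :
    ∑ n ∈ Finset.range T, min 1 (N * Real.exp (-(a * n))) ≤ Real.log N / a + 2 + 1 / a := by
  have hN0 : 0 < N := by linarith
  set t₀ := ⌈Real.log N / a⌉₊ with ht₀
  have hlog : 0 ≤ Real.log N / a := div_nonneg (Real.log_nonneg hN) ha.le
  have h1 : (t₀ : ℝ) ≤ Real.log N / a + 1 := (Nat.ceil_lt_add_one hlog).le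
  have h2 : Real.log N ≤ a * t₀ := by
    have := Nat.le_ceil (Real.log N / a)
    rw [div_le_iff₀ ha] at this
    linarith
  have hpos : ∀ n : ℕ, 0 ≤ min 1 (N * Real.exp (-(a * n))) := fun n =>
    le_min zero_le_one (by positivity)
  calc ∑ n ∈ Finset.range T, min 1 (N * Real.exp (-(a * n)))
      ≤ ∑ n ∈ Finset.range (t₀ + T), min 1 (N * Real.exp (-(a * n))) :=
        Finset.sum_le_sum_of_subset_of_nonneg
          (Finset.range_subset_range.2 (Nat.le_add_left _ _)) fun n _ _ => hpos n
    _ ≤ ∑ n ∈ Finset.range t₀, (1 : ℝ) + ∑ n ∈ Finset.range T, Real.exp (-a) ^ n := by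
        rw [Finset.sum_range_add]
        refine add_le_add (Finset.sum_le_sum fun n _ => min_le_left _ _)
          (Finset.sum_le_sum fun n _ => (min_le_right _ _).trans ?_)
        have : Real.exp (-a) ^ n = Real.exp (-(a * n)) := by
          rw [← Real.exp_nat_mul]; ring_nf
        rw [this]
        nth_rewrite 1 [← Real.exp_log hN0]
        rw [← Real.exp_add, Real.exp_le_exp]
        push_cast
        linarith
    _ ≤ (Real.log N / a + 1) + (1 + 1 / a) := by
        refine add_le_add (by simpa using h1) ?_
        have hlt : Real.exp (-a) < 1 := by rw [Real.exp_lt_one_iff]; linarith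
        have hgs : ∑ n ∈ Finset.range T, Real.exp (-a) ^ n ≤ (1 - Real.exp (-a))⁻¹ := by
          have := (summable_geometric_of_lt_one (Real.exp_pos _).le hlt).sum_le_tsum
            (Finset.range T) fun n _ => by positivity
          rwa [tsum_geometric_of_lt_one (Real.exp_pos _).le hlt] at this
        refine hgs.trans ?_
        have h3 : 1 + a ≤ Real.exp a := by linarith [Real.add_one_le_exp a]
        have h4 : Real.exp (-a) ≤ 1 / (1 + a) := by
          rw [Real.exp_neg, ← one_div]
          exact one_div_le_one_div_of_le (by positivity) h3
        have h5 : a / (1 + a) ≤ 1 - Real.exp (-a) := by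
          have : a / (1 + a) = 1 - 1 / (1 + a) := by field_simp; ring
          linarith
        have h6 : 1 + 1 / a = (a / (1 + a))⁻¹ := by field_simp; ring
        rw [h6]
        exact inv_anti₀ (by positivity) h5
    _ = _ := by ring

/-- If `θ ↦ exp (c θ²) p - p - θ q` is nonnegative, it is minimal at `0`, where its derivative is
`-q`. -/
lemma eq_zero_of_forall_add_mul_le_exp {p q c : ℝ}
    (h : ∀ θ : ℝ, p + θ * q ≤ Real.exp (c * θ ^ 2) * p) : q = 0 := by
  have hmin : IsLocalMin (fun θ : ℝ => Real.exp (c * θ ^ 2) * p - p - θ * q) 0 :=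
    Filter.Eventually.of_forall fun θ => by
      have := h θ
      simp only [ne_eq, OfNat.ofNat_ne_zero, not_false_eq_true, zero_pow, mul_zero, Real.exp_zero,
        one_mul, sub_self, zero_mul]
      linarith
  have hd : HasDerivAt (fun θ : ℝ => Real.exp (c * θ ^ 2) * p - p - θ * q)
      (Real.exp (c * 0 ^ 2) * (c * (2 * 0)) * p - 1 * q) 0 := by
    have h1 : HasDerivAt (fun θ : ℝ => c * θ ^ 2) (c * (2 * 0)) 0 := by
      simpa using ((hasDerivAt_id (0 : ℝ)).pow 2).const_mul c
    exact ((h1.exp.mul_const p).sub_const p).sub ((hasDerivAt_id (0 : ℝ)).mul_const q)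
  have := hmin.hasDerivAt_eq_zero hd
  simpa using this

lemma exists_tendsto_of_finite_range {Ω : Type*} {K : ℕ} {m : MeasurableSpace Ω}
    {l : Ω → Fin K → ℝ} (hl : Measurable l) :
    ∃ f : ℕ → Ω → Fin K → ℝ, (∀ n, Measurable (f n)) ∧ (∀ n, (Set.range (f n)).Finite) ∧
      ∀ ω, Filter.Tendsto (fun n => f n ω) Filter.atTop (nhds (l ω)) :=
  ⟨fun n => hl.stronglyMeasurable.approx n, fun n => (hl.stronglyMeasurable.approx n).measurable,
    fun n => (hl.stronglyMeasurable.approx n).finite_range, hl.stronglyMeasurable.tendsto_approx⟩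

/-! ### Conditionally sub-Gaussian increments -/

section Subgaussian

variable {Ω : Type*} {m m0 : MeasurableSpace Ω} {μ : Measure Ω}

/-- `Y` is sub-Gaussian with variance proxy `v` conditionally on `m`:
`𝔼[exp (θ Y) | m] ≤ exp (θ² v / 2)` for all real `θ`.  The inequality is tested against
`m`-measurable weights in `[0, ∞]`, so that it makes sense without integrability conditions. -/
def IsCondSubgaussian (m : MeasurableSpace Ω) {m0 : MeasurableSpace Ω} (μ : Measure Ω)
    (Y : Ω → ℝ) (v : ℝ) : Prop :=
  ∀ (θ : ℝ) (g : Ω → ENNReal), Measurable[m] g →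
    ∫⁻ ω, g ω * ENNReal.ofReal (Real.exp (θ * Y ω - θ ^ 2 * v / 2)) ∂μ ≤ ∫⁻ ω, g ω ∂μ

/-- A bound for integrals over the sets of a sub-σ-algebra extends to weights that are measurable
with respect to it. -/
lemma lintegral_mul_le_of_setLIntegral_le (hm : m ≤ m0) {f : Ω → ENNReal} (hf : Measurable f)
    {c : ENNReal} (h : ∀ A, MeasurableSet[m] A → ∫⁻ ω in A, f ω ∂μ ≤ c * μ A)
    {g : Ω → ENNReal} (hg : Measurable[m] g) :
    ∫⁻ ω, g ω * f ω ∂μ ≤ c * ∫⁻ ω, g ω ∂μ := by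
  have hle : (μ.withDensity f).trim hm ≤ (c • μ).trim hm := by
    refine Measure.le_iff.2 fun A hA => ?_
    rw [trim_measurableSet_eq hm hA, trim_measurableSet_eq hm hA,
      withDensity_apply _ (hm A hA)]
    simpa using h A hA
  calc ∫⁻ ω, g ω * f ω ∂μ = ∫⁻ ω, g ω ∂(μ.withDensity f) := by
        rw [lintegral_withDensity_eq_lintegral_mul _ hf (hg.mono hm le_rfl)]
        exact lintegral_congr fun ω => by simp [mul_comm]
    _ = ∫⁻ ω, g ω ∂((μ.withDensity f).trim hm) := (lintegral_trim hm hg).symm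
    _ ≤ ∫⁻ ω, g ω ∂((c • μ).trim hm) := lintegral_mono' hle le_rfl
    _ = c * ∫⁻ ω, g ω ∂μ := by rw [lintegral_trim hm hg, lintegral_smul_measure, smul_eq_mul]

lemma lintegral_mul_exp_sub_le (hm : m ≤ m0) [IsFiniteMeasure μ] {Z : Ω → ℝ} (hZ : Measurable Z)
    (hint : Integrable (fun ω => Real.exp (Z ω)) μ) {v : ℝ}
    (h : ∀ A, MeasurableSet[m] A → ∫ ω in A, Real.exp (Z ω) ∂μ ≤ Real.exp v * μ.real A)
    {g : Ω → ENNReal} (hg : Measurable[m] g) :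
    ∫⁻ ω, g ω * ENNReal.ofReal (Real.exp (Z ω - v)) ∂μ ≤ ∫⁻ ω, g ω ∂μ := by
  refine (lintegral_mul_le_of_setLIntegral_le (c := 1) hm (by fun_prop) (fun A hA => ?_) hg).trans
    (one_mul _).le
  have hint' : Integrable (fun ω => Real.exp (Z ω - v)) μ := by
    simp only [Real.exp_sub]
    exact hint.div_const _
  rw [← ofReal_integral_eq_lintegral_ofReal hint'.integrableOn
    (ae_of_all _ fun _ => (Real.exp_pos _).le), one_mul, ← ofReal_measureReal]
  refine ENNReal.ofReal_le_ofReal ?_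
  simp only [Real.exp_sub, integral_div]
  rw [div_le_iff₀ (Real.exp_pos _), mul_comm]
  exact h A hA

/-- Hoeffding's lemma: a bounded variable whose integral vanishes on all sets of `m` is
sub-Gaussian conditionally on `m`. The chord of `exp` over `[-c, c]` lies above `exp`, and its
conditional mean is `cosh (θ c) ≤ exp (θ² c² / 2)`. -/
lemma isCondSubgaussian_of_bounded (hm : m ≤ m0) [IsFiniteMeasure μ] {Y : Ω → ℝ}
    (hY : Measurable Y) {c : ℝ} (hc : 0 < c) (hb : ∀ᵐ ω ∂μ, |Y ω| ≤ c)
    (h0 : ∀ A, MeasurableSet[m] A → ∫ ω in A, Y ω ∂μ = 0) :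
    IsCondSubgaussian m μ Y (c ^ 2) := by
  intro θ g hg
  have hYint : Integrable Y μ := Integrable.of_bound hY.aestronglyMeasurable c hb
  have hchord : ∀ᵐ ω ∂μ, Real.exp (θ * Y ω)
      ≤ Real.cosh (θ * c) + Y ω * (Real.sinh (θ * c) / c) := by
    filter_upwards [hb] with ω hω
    have hω' := abs_le.1 hω
    obtain ⟨-, hconv⟩ := convexOn_exp
    have := hconv (Set.mem_univ (-(θ * c))) (Set.mem_univ (θ * c))
      (a := (c - Y ω) / (2 * c)) (b := (c + Y ω) / (2 * c))
      (div_nonneg (by linarith) (by positivity)) (div_nonneg (by linarith) (by positivity))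
      (by field_simp; ring)
    simp only [smul_eq_mul] at this
    have e1 : (c - Y ω) / (2 * c) * -(θ * c) + (c + Y ω) / (2 * c) * (θ * c) = θ * Y ω := by
      field_simp; ring
    rw [e1] at this
    refine this.trans_eq ?_
    rw [Real.cosh_eq, Real.sinh_eq]
    field_simp
    ring
  have hexp : Integrable (fun ω => Real.exp (θ * Y ω)) μ := by
    refine Integrable.of_bound (by fun_prop) (Real.exp (|θ| * c)) ?_
    filter_upwards [hb] with ω hω
    rw [Real.norm_eq_abs, Real.abs_exp, Real.exp_le_exp]
    calc θ * Y ω ≤ |θ * Y ω| := le_abs_self _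
      _ = |θ| * |Y ω| := abs_mul _ _
      _ ≤ |θ| * c := by gcongr
  refine lintegral_mul_exp_sub_le hm (by fun_prop) hexp (fun A hA => ?_) hg
  calc ∫ ω in A, Real.exp (θ * Y ω) ∂μ
      ≤ ∫ ω in A, (Real.cosh (θ * c) + Y ω * (Real.sinh (θ * c) / c)) ∂μ :=
        integral_mono_ae hexp.integrableOn
          ((integrable_const _).add (hYint.mul_const _)).integrableOn
          (ae_restrict_of_ae hchord)
    _ = Real.cosh (θ * c) * μ.real A := by
        rw [integral_add (integrable_const _) (hYint.mul_const _).integrableOn,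
          integral_mul_const, h0 A hA]
        simp [mul_comm]
    _ ≤ Real.exp (θ ^ 2 * c ^ 2 / 2) * μ.real A := by
        gcongr
        have := Real.cosh_le_exp_half_sq (θ * c)
        rwa [mul_pow] at this

/-- Sub-Gaussian bounds for constant linear combinations carry over to `m`-measurable random
coefficients: they do so for simple functions, and Fatou's lemma applies to the limit because the
compensated exponential has total weight at most that of `g`. -/
lemma lintegral_mul_exp_random_coeff_le {K : ℕ} (hm : m ≤ m0) {ε : Ω → Fin K → ℝ}
    (hε : Measurable ε) {σ : ℝ}
    (h : ∀ (l : Fin K → ℝ) (g : Ω → ENNReal), Measurable[m] g →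
      ∫⁻ ω, g ω * ENNReal.ofReal (Real.exp (∑ k, l k * ε ω k - σ ^ 2 * (∑ k, l k ^ 2) / 2)) ∂μ
        ≤ ∫⁻ ω, g ω ∂μ)
    {l : Ω → Fin K → ℝ} (hl : Measurable[m] l) {g : Ω → ENNReal} (hg : Measurable[m] g) :
    ∫⁻ ω, g ω * ENNReal.ofReal
        (Real.exp (∑ k, l ω k * ε ω k - σ ^ 2 * (∑ k, l ω k ^ 2) / 2)) ∂μ
      ≤ ∫⁻ ω, g ω ∂μ := by
  obtain ⟨f, hfm, hfin, hf⟩ := exists_tendsto_of_finite_range hl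
  have hsimple : ∀ n, ∫⁻ ω, g ω * ENNReal.ofReal (Real.exp (∑ k, f n ω k * ε ω k
      - σ ^ 2 * (∑ k, f n ω k ^ 2) / 2)) ∂μ ≤ ∫⁻ ω, g ω ∂μ := by
    intro n
    have hset : ∀ v, MeasurableSet[m] (f n ⁻¹' {v}) :=
      fun v => hfm n (measurableSet_singleton v)
    have hsplit : ∀ F : (Fin K → ℝ) → Ω → ENNReal, ∀ ω, F (f n ω) ω =
        ∑ v ∈ (hfin n).toFinset, (f n ⁻¹' {v}).indicator (F v) ω := by
      intro F ω
      rw [Finset.sum_eq_single_of_mem (f n ω) ((hfin n).mem_toFinset.2 ⟨ω, rfl⟩)]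
      · simp
      · intro v _ hv
        exact Set.indicator_of_notMem (fun hω => hv hω.symm) _
    have hgm : ∀ v, Measurable[m] ((f n ⁻¹' {v}).indicator g) :=
      fun v => hg.indicator (hset v)
    calc ∫⁻ ω, g ω * ENNReal.ofReal (Real.exp (∑ k, f n ω k * ε ω k
          - σ ^ 2 * (∑ k, f n ω k ^ 2) / 2)) ∂μ
        = ∫⁻ ω, ∑ v ∈ (hfin n).toFinset, (f n ⁻¹' {v}).indicator g ω *
            ENNReal.ofReal (Real.exp (∑ k, v k * ε ω k - σ ^ 2 * (∑ k, v k ^ 2) / 2)) ∂μ := by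
          refine lintegral_congr fun ω => ?_
          rw [hsplit (fun v ω => g ω * ENNReal.ofReal
            (Real.exp (∑ k, v k * ε ω k - σ ^ 2 * (∑ k, v k ^ 2) / 2))) ω]
          refine Finset.sum_congr rfl fun v _ => ?_
          by_cases hω : ω ∈ f n ⁻¹' {v}
          · simp only [Set.indicator_of_mem hω]
          · simp only [Set.indicator_of_notMem hω, zero_mul]
      _ = ∑ v ∈ (hfin n).toFinset, ∫⁻ ω, (f n ⁻¹' {v}).indicator g ω *
            ENNReal.ofReal (Real.exp (∑ k, v k * ε ω k - σ ^ 2 * (∑ k, v k ^ 2) / 2)) ∂μ :=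
          lintegral_finsetSum _ fun v _ => ((hgm v).mono hm le_rfl).mul (by fun_prop)
      _ ≤ ∑ v ∈ (hfin n).toFinset, ∫⁻ ω, (f n ⁻¹' {v}).indicator g ω ∂μ :=
          Finset.sum_le_sum fun v _ => h v _ (hgm v)
      _ = ∫⁻ ω, g ω ∂μ := by
          rw [← lintegral_finsetSum _ fun v _ => (hgm v).mono hm le_rfl]
          exact lintegral_congr fun ω => (hsplit (fun _ => g) ω).symm
  have happrox : ∀ n, Measurable (f n) := fun n => (hfm n).mono hm le_rfl
  have hg0 : Measurable g := hg.mono hm le_rfl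
  have hlim : ∀ ω, Filter.Tendsto (fun n => g ω * ENNReal.ofReal (Real.exp
      (∑ k, f n ω k * ε ω k - σ ^ 2 * (∑ k, f n ω k ^ 2) / 2)))
      Filter.atTop (nhds (g ω * ENNReal.ofReal
        (Real.exp (∑ k, l ω k * ε ω k - σ ^ 2 * (∑ k, l ω k ^ 2) / 2)))) := by
    intro ω
    have hk : ∀ k, Filter.Tendsto (fun n => f n ω k) Filter.atTop (nhds (l ω k)) :=
      fun k => (continuous_apply k).continuousAt.tendsto.comp (hf ω)
    refine ENNReal.Tendsto.const_mul ?_ (Or.inl (ENNReal.ofReal_pos.2 (Real.exp_pos _)).ne')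
    refine ENNReal.tendsto_ofReal ((Real.continuous_exp.tendsto _).comp ?_)
    exact (tendsto_finsetSum _ fun k _ => (hk k).mul_const _).sub
      (((tendsto_finsetSum _ fun k _ => (hk k).pow 2).const_mul _).div_const _)
  calc ∫⁻ ω, g ω * ENNReal.ofReal
        (Real.exp (∑ k, l ω k * ε ω k - σ ^ 2 * (∑ k, l ω k ^ 2) / 2)) ∂μ
      = ∫⁻ ω, Filter.liminf (fun n => g ω * ENNReal.ofReal (Real.exp
          (∑ k, f n ω k * ε ω k - σ ^ 2 * (∑ k, f n ω k ^ 2) / 2)))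
          Filter.atTop ∂μ := lintegral_congr fun ω => (hlim ω).liminf_eq.symm
    _ ≤ Filter.liminf (fun n => ∫⁻ ω, g ω * ENNReal.ofReal (Real.exp
          (∑ k, f n ω k * ε ω k - σ ^ 2 * (∑ k, f n ω k ^ 2) / 2)) ∂μ)
          Filter.atTop := lintegral_liminf_le fun n => by
            have := happrox n
            fun_prop
    _ ≤ ∫⁻ ω, g ω ∂μ := by
        refine (Filter.liminf_le_liminf (Filter.Eventually.of_forall hsimple)).trans ?_
        simp

/-- Azuma–Hoeffding: a sum of `n` increments, each sub-Gaussian conditionally on a σ-algebra that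
contains the past, has a sub-Gaussian tail. -/
lemma measure_abs_sum_ge_le [IsProbabilityMeasure μ] {n : ℕ} (hn : 1 ≤ n)
    {F : ℕ → MeasurableSpace Ω}
    {Y : ℕ → Ω → ℝ} {v : ℝ} (hv : 0 < v)
    (hY : ∀ s ∈ Finset.Icc 1 n, IsCondSubgaussian (F s) μ (Y s) v)
    (hpast : ∀ s ∈ Finset.Icc 1 n, ∀ r ∈ Finset.Icc 1 (s - 1), Measurable[F s] (Y r))
    (hmeas : ∀ s ∈ Finset.Icc 1 n, Measurable (Y s)) {a : ℝ} (ha : 0 ≤ a) :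
    μ.real {ω | a ≤ |∑ s ∈ Finset.Icc 1 n, Y s ω|} ≤ 2 * Real.exp (-(a ^ 2 / (2 * n * v))) := by
  have hprod : ∀ θ : ℝ, ∀ t ≤ n, ∫⁻ ω, ∏ s ∈ Finset.Icc 1 t,
      ENNReal.ofReal (Real.exp (θ * Y s ω - θ ^ 2 * v / 2)) ∂μ ≤ 1 := by
    intro θ t
    induction t with
    | zero => intro _; simp
    | succ t ih =>
      intro ht
      have hmem : t + 1 ∈ Finset.Icc 1 n := Finset.mem_Icc.2 ⟨by omega, ht⟩
      simp only [Finset.prod_Icc_succ_top (Nat.le_add_left 1 t)]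
      refine le_trans (hY (t + 1) hmem θ _ ?_) (ih (by omega))
      refine Finset.measurable_prod _ fun s hs => ?_
      have := hpast (t + 1) hmem s (by simpa using hs)
      fun_prop
  have hn0 : (0 : ℝ) < n := by exact_mod_cast hn
  -- Markov's inequality at the optimal exponent `θ = ± a / (n v)`.
  have hside : ∀ θ : ℝ, θ ^ 2 = (a / (n * v)) ^ 2 →
      μ.real {ω | θ * ∑ s ∈ Finset.Icc 1 n, Y s ω ≥ a ^ 2 / (n * v)}
        ≤ Real.exp (-(a ^ 2 / (2 * n * v))) := by
    intro θ hθ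
    have hval : n * (θ ^ 2 * v / 2) = a ^ 2 / (2 * n * v) := by
      rw [hθ]; field_simp
    refine ENNReal.toReal_le_of_le_ofReal (Real.exp_pos _).le ?_
    have hpr : ∀ ω, ∏ s ∈ Finset.Icc 1 n,
        ENNReal.ofReal (Real.exp (θ * Y s ω - θ ^ 2 * v / 2)) =
        ENNReal.ofReal (Real.exp (θ * ∑ s ∈ Finset.Icc 1 n, Y s ω - a ^ 2 / (2 * n * v))) := by
      intro ω
      rw [← ENNReal.ofReal_prod_of_nonneg fun _ _ => (Real.exp_pos _).le, ← Real.exp_sum,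
        Finset.sum_sub_distrib, ← Finset.mul_sum]
      simp [hval]
    have hint := hprod θ n le_rfl
    simp only [hpr] at hint
    have hmS : Measurable fun ω => ∑ s ∈ Finset.Icc 1 n, Y s ω :=
      Finset.measurable_sum _ hmeas
    have hmarkov := mul_meas_ge_le_lintegral (μ := μ) (f := fun ω => ENNReal.ofReal
      (Real.exp (θ * ∑ s ∈ Finset.Icc 1 n, Y s ω - a ^ 2 / (2 * n * v)))) (by fun_prop)
      (ENNReal.ofReal (Real.exp (a ^ 2 / (2 * n * v))))
    have hsub : {ω | θ * ∑ s ∈ Finset.Icc 1 n, Y s ω ≥ a ^ 2 / (n * v)} ⊆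
        {ω | ENNReal.ofReal (Real.exp (a ^ 2 / (2 * n * v))) ≤ ENNReal.ofReal
          (Real.exp (θ * ∑ s ∈ Finset.Icc 1 n, Y s ω - a ^ 2 / (2 * n * v)))} := by
      intro ω hω
      refine ENNReal.ofReal_le_ofReal (Real.exp_le_exp.2 ?_)
      have e : a ^ 2 / (n * v) = a ^ 2 / (2 * n * v) + a ^ 2 / (2 * n * v) := by
        field_simp; ring
      have hω' : a ^ 2 / (n * v) ≤ θ * ∑ s ∈ Finset.Icc 1 n, Y s ω := hω
      linarith
    have h1 : ENNReal.ofReal (Real.exp (a ^ 2 / (2 * n * v))) *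
        μ {ω | θ * ∑ s ∈ Finset.Icc 1 n, Y s ω ≥ a ^ 2 / (n * v)} ≤ 1 :=
      (mul_le_mul_right (measure_mono hsub) _).trans (hmarkov.trans hint)
    rw [Real.exp_neg, ENNReal.ofReal_inv_of_pos (Real.exp_pos _)]
    rw [ENNReal.le_inv_iff_mul_le, mul_comm]
    exact h1
  have hsub : {ω | a ≤ |∑ s ∈ Finset.Icc 1 n, Y s ω|} ⊆
      {ω | (a / (n * v)) * ∑ s ∈ Finset.Icc 1 n, Y s ω ≥ a ^ 2 / (n * v)} ∪
      {ω | (-(a / (n * v))) * ∑ s ∈ Finset.Icc 1 n, Y s ω ≥ a ^ 2 / (n * v)} := by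
    intro ω hω
    have hq : 0 ≤ a / (n * v) := by positivity
    have e : a ^ 2 / (n * v) = a / (n * v) * a := by ring
    rcases le_abs.1 (show a ≤ |∑ s ∈ Finset.Icc 1 n, Y s ω| from hω) with h | h
    · left
      show a ^ 2 / (n * v) ≤ _
      rw [e]
      exact mul_le_mul_of_nonneg_left h hq
    · right
      show a ^ 2 / (n * v) ≤ _
      rw [e, neg_mul, ← mul_neg]
      exact mul_le_mul_of_nonneg_left h hq
  calc _ ≤ _ := measureReal_mono hsub
    _ ≤ _ := measureReal_union_le _ _
    _ ≤ Real.exp (-(a ^ 2 / (2 * n * v))) + Real.exp (-(a ^ 2 / (2 * n * v))) :=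
        add_le_add (hside _ rfl) (hside _ (by ring))
    _ = _ := by ring

end Subgaussian

/-! ### The LASSO estimate -/

section Lasso

variable {d : ℕ}

lemma l1On_nonneg (A : Finset (Fin d)) (v : Fin d → ℝ) : 0 ≤ l1On A v :=
  Finset.sum_nonneg fun _ _ => abs_nonneg _

lemma l1On_add_compl (A : Finset (Fin d)) (v : Fin d → ℝ) : l1On A v + l1On Aᶜ v = l1 v :=
  Finset.sum_add_sum_compl A _

lemma abs_sum_mul_le {w v : Fin d → ℝ} {c : ℝ} (h : ∀ i, |w i| ≤ c) :
    |∑ i, w i * v i| ≤ c * l1 v := by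
  refine (Finset.abs_sum_le_sum_abs _ _).trans ?_
  rw [l1, Finset.mul_sum]
  refine Finset.sum_le_sum fun i _ => ?_
  rw [abs_mul]
  exact mul_le_mul_of_nonneg_right (h i) (abs_nonneg _)

/-- The `ℓ¹`-norms of `β` and of a perturbation `β + v`: outside the support of `β` the
perturbation adds up, on the support the triangle inequality holds. -/
lemma l1_sub_l1_add_le (β v : Fin d → ℝ) :
    l1 β - l1 (β + v) ≤ l1On (activeSet β) v - l1On (activeSet β)ᶜ v := by
  rw [← l1On_add_compl (activeSet β) β, ← l1On_add_compl (activeSet β) (β + v)]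
  have hz : ∀ i ∈ (activeSet β)ᶜ, β i = 0 := fun i hi => by simpa [activeSet] using hi
  have h1 : l1On (activeSet β)ᶜ β = 0 :=
    Finset.sum_eq_zero fun i hi => by rw [hz i hi, abs_zero]
  have h2 : l1On (activeSet β)ᶜ (β + v) = l1On (activeSet β)ᶜ v :=
    Finset.sum_congr rfl fun i hi => by rw [Pi.add_apply, hz i hi, zero_add]
  have h3 : l1On (activeSet β) β ≤ l1On (activeSet β) (β + v) + l1On (activeSet β) v := by
    rw [l1On, l1On, l1On, ← Finset.sum_add_distrib]
    refine Finset.sum_le_sum fun i _ => ?_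
    have := abs_sub (β i + v i) (v i)
    simpa using this
  linarith

/-- The oracle inequality of the LASSO, with design `x`, noise `e` and `N` observations: if the
penalty dominates the noise and the empirical Gram matrix satisfies the compatibility condition
with constant `c`, then the estimate is `ℓ¹`-close to `β`.  Without penalty the cone condition is
void only if every coordinate is active, hence `hlam`. -/
lemma l1_lasso_error_le {ι : Type*} (A : Finset ι) (x : ι → Fin d → ℝ) (e : ι → ℝ)
    {N lam c : ℝ} (hN : 0 < N) (hc : 0 < c) (β b : Fin d → ℝ) (hlam0 : 0 ≤ lam)
    (hlam : lam = 0 → (activeSet β)ᶜ = ∅)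
    (hmin : 1 / N * ∑ i ∈ A, (x i ⬝ᵥ β + e i - x i ⬝ᵥ b) ^ 2 + lam * l1 b
      ≤ 1 / N * ∑ i ∈ A, (x i ⬝ᵥ β + e i - x i ⬝ᵥ β) ^ 2 + lam * l1 β)
    (hnoise : ∀ j, |∑ i ∈ A, e i * x i j| ≤ N * lam / 4)
    (hcompat : ∀ v, v ≠ 0 → l1On (activeSet β)ᶜ v ≤ 3 * l1On (activeSet β) v →
      c * l1On (activeSet β) v ^ 2
        ≤ (activeSet β).card * (1 / N * ∑ i ∈ A, (x i ⬝ᵥ v) ^ 2)) :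
    l1 (b - β) ≤ 4 * lam * (activeSet β).card / c := by
  set v := b - β with hv
  have hb : b = β + v := by rw [hv]; abel
  set q := 1 / N * ∑ i ∈ A, (x i ⬝ᵥ v) ^ 2 with hq
  have hsq : ∑ i ∈ A, (x i ⬝ᵥ β + e i - x i ⬝ᵥ b) ^ 2 =
      ∑ i ∈ A, (x i ⬝ᵥ β + e i - x i ⬝ᵥ β) ^ 2 - 2 * ∑ i ∈ A, e i * (x i ⬝ᵥ v)
        + ∑ i ∈ A, (x i ⬝ᵥ v) ^ 2 := by
    rw [Finset.mul_sum, ← Finset.sum_sub_distrib, ← Finset.sum_add_distrib]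
    refine Finset.sum_congr rfl fun i _ => ?_
    rw [hb, dotProduct_add]
    ring
  have hcross : ∑ i ∈ A, e i * (x i ⬝ᵥ v) = ∑ j, (∑ i ∈ A, e i * x i j) * v j := by
    simp only [dotProduct, Finset.mul_sum, Finset.sum_mul]
    rw [Finset.sum_comm]
    exact Finset.sum_congr rfl fun _ _ => Finset.sum_congr rfl fun _ _ => by ring
  have hcr : ∑ i ∈ A, e i * (x i ⬝ᵥ v) ≤ N * lam / 4 * l1 v := by
    rw [hcross]
    exact (le_abs_self _).trans (abs_sum_mul_le hnoise)
  have hdiff := mul_le_mul_of_nonneg_left (l1_sub_l1_add_le β v) hlam0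
  rw [← hb] at hdiff
  have hsplit := l1On_add_compl (activeSet β) v
  have hbasic : 2 * q + lam * l1On (activeSet β)ᶜ v ≤ 3 * (lam * l1On (activeSet β) v) := by
    rw [hsq] at hmin
    have h1 : q ≤ 1 / N * (2 * ∑ i ∈ A, e i * (x i ⬝ᵥ v)) + lam * l1 β - lam * l1 b := by
      rw [hq]; linarith
    have h2 : 1 / N * (2 * ∑ i ∈ A, e i * (x i ⬝ᵥ v)) ≤ lam * l1 v / 2 := by
      calc 1 / N * (2 * ∑ i ∈ A, e i * (x i ⬝ᵥ v)) ≤ 1 / N * (2 * (N * lam / 4 * l1 v)) := by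
            gcongr
        _ = lam * l1 v / 2 := by field_simp; ring
    rw [← hsplit] at h2
    linarith
  have hq0 : 0 ≤ q := by positivity
  have hS0 := l1On_nonneg (activeSet β) v
  have hcone : l1On (activeSet β)ᶜ v ≤ 3 * l1On (activeSet β) v := by
    rcases hlam0.eq_or_lt with h | h
    · rw [hlam h.symm]
      simp only [l1On, Finset.sum_empty]
      exact mul_nonneg (by norm_num) hS0
    · refine le_of_mul_le_mul_left ?_ h
      linarith
  by_cases hv0 : v = 0
  · rw [hv0]
    simp only [l1, Pi.zero_apply, abs_zero, Finset.sum_const_zero]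
    exact div_nonneg (mul_nonneg (mul_nonneg zero_le_four hlam0) (Nat.cast_nonneg _)) hc.le
  have hcomp := hcompat v hv0 hcone
  rw [le_div_iff₀ hc]
  rcases hlam0.eq_or_lt with h | h
  · -- without penalty the residual vanishes, and so does `v`
    have hq1 : q = 0 := by rw [← h] at hbasic; linarith
    change c * _ ≤ _ * q at hcomp
    rw [hq1, mul_zero] at hcomp
    have : l1On (activeSet β) v ^ 2 = 0 :=
      le_antisymm (nonpos_of_mul_nonpos_right hcomp hc) (sq_nonneg _)
    have h0 : l1On (activeSet β) v = 0 := by simpa using this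
    rw [← hsplit, h0, le_antisymm (by rwa [h0, mul_zero] at hcone) (l1On_nonneg _ v)]
    rw [← h]
    simp
  · -- `4 λ ‖v_S‖ ≤ 2 q + 2 λ² s / c` by the inequality of the means
    change c * _ ≤ (activeSet β).card * q at hcomp
    set S := l1On (activeSet β) v
    set s := ((activeSet β).card : ℝ)
    have hs0 : 0 ≤ s := Nat.cast_nonneg _
    have h1 : lam * l1 v ≤ 4 * (lam * S) - 2 * q := by rw [← hsplit]; linarith
    have h2 : s * (c * (lam * l1 v)) ≤ s * (4 * lam ^ 2 * s) := by
      have h3 : s * c * (lam * l1 v) ≤ s * c * (4 * (lam * S) - 2 * q) :=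
        mul_le_mul_of_nonneg_left h1 (mul_nonneg hs0 hc.le)
      nlinarith [sq_nonneg (c * S - lam * s), sq_nonneg (lam * s),
        mul_le_mul_of_nonneg_left hcomp hc.le]
    rcases hs0.eq_or_lt with h4 | h4
    · -- an empty support forces `S = 0`, hence `v = 0`
      have hSe : S = 0 := by
        have : (activeSet β) = ∅ := by
          rw [← Finset.card_eq_zero]; exact Nat.cast_eq_zero.1 h4.symm
        simp only [S, this, l1On, Finset.sum_empty]
      have : l1On (activeSet β)ᶜ v = 0 :=
        le_antisymm (by linarith) (l1On_nonneg _ v)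
      rw [← hsplit, this, hSe]
      simp only [add_zero, zero_mul]
      exact mul_nonneg (mul_nonneg zero_le_four hlam0) hs0
    · have h5 := le_of_mul_le_mul_left h2 h4
      refine le_of_mul_le_mul_left ?_ h
      linarith

/-- A lower bound of the compatibility constant as an inequality between quadratic forms. -/
lemma sq_mul_le_of_lt_compatConst {S : Finset (Fin d)} {M : Matrix (Fin d) (Fin d) ℝ} {φ : ℝ}
    (hφ : 0 < φ) (h : φ < compatConst S M) {v : Fin d → ℝ} (hv : v ≠ 0)
    (hcone : l1On Sᶜ v ≤ 3 * l1On S v) :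
    φ ^ 2 * l1On S v ^ 2 ≤ S.card * (v ⬝ᵥ (M *ᵥ v)) := by
  have h1 : φ < √((S.card : ℝ) * ((v ⬝ᵥ (M *ᵥ v)) / (l1On S v) ^ 2)) := by
    refine h.trans_le (csInf_le ⟨0, ?_⟩ ⟨v, hv, hcone, rfl⟩)
    rintro _ ⟨_, _, _, rfl⟩
    exact Real.sqrt_nonneg _
  have h2 := (Real.lt_sqrt hφ.le).1 h1
  rcases (l1On_nonneg S v).eq_or_lt with h3 | h3
  · rw [← h3] at h2
    simp at h2
    nlinarith
  · rw [← mul_div_assoc, lt_div_iff₀ (by positivity)] at h2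
    exact h2.le

lemma dotProduct_mulVec_eq_sum (M : Matrix (Fin d) (Fin d) ℝ) (v : Fin d → ℝ) :
    v ⬝ᵥ (M *ᵥ v) = ∑ i, ∑ j, M i j * v j * v i := by
  simp only [dotProduct, Matrix.mulVec, Finset.mul_sum]
  exact Finset.sum_congr rfl fun _ _ => Finset.sum_congr rfl fun _ _ => by ring

/-- The quadratic forms of entrywise close matrices are close in terms of the `ℓ¹`-norm. -/
lemma abs_quadratic_form_sub_le {M M' : Matrix (Fin d) (Fin d) ℝ} {δ : ℝ}
    (h : ∀ i j, |M i j - M' i j| ≤ δ) (v : Fin d → ℝ) :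
    |v ⬝ᵥ (M *ᵥ v) - v ⬝ᵥ (M' *ᵥ v)| ≤ δ * l1 v ^ 2 := by
  have e : v ⬝ᵥ (M *ᵥ v) - v ⬝ᵥ (M' *ᵥ v) = ∑ i, (∑ j, (M i j - M' i j) * v j) * v i := by
    rw [dotProduct_mulVec_eq_sum, dotProduct_mulVec_eq_sum, ← Finset.sum_sub_distrib]
    refine Finset.sum_congr rfl fun i _ => ?_
    rw [Finset.sum_mul, ← Finset.sum_sub_distrib]
    exact Finset.sum_congr rfl fun _ _ => by ring
  rw [e]
  calc _ ≤ δ * l1 v * l1 v := abs_sum_mul_le fun i => abs_sum_mul_le (h i)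
    _ = _ := by ring

/-- If `M` is entrywise `φ² / (32 |S|)`-close to a matrix with compatibility constant above `φ`,
then it is compatible with constant `φ / √2`: on the cone `‖v‖₁ ≤ 4 ‖v‖_{S,1}`. -/
lemma half_sq_mul_le_of_close {S : Finset (Fin d)} {M M' : Matrix (Fin d) (Fin d) ℝ} {φ : ℝ}
    (hφ : 0 < φ) (hS : 1 ≤ S.card) (h : φ < compatConst S M')
    (hclose : ∀ i j, |M i j - M' i j| ≤ φ ^ 2 / (32 * S.card)) {v : Fin d → ℝ} (hv : v ≠ 0)
    (hcone : l1On Sᶜ v ≤ 3 * l1On S v) :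
    φ ^ 2 / 2 * l1On S v ^ 2 ≤ S.card * (v ⬝ᵥ (M *ᵥ v)) := by
  have h1 := sq_mul_le_of_lt_compatConst hφ h hv hcone
  have h2 := abs_le.1 (abs_quadratic_form_sub_le hclose v)
  have hs : (0 : ℝ) < S.card := by exact_mod_cast hS
  have h3 : l1 v ≤ 4 * l1On S v := by rw [← l1On_add_compl S v]; linarith
  have h4 : l1 v ^ 2 ≤ (4 * l1On S v) ^ 2 := by
    refine pow_le_pow_left₀ ?_ h3 2
    exact Finset.sum_nonneg fun _ _ => abs_nonneg _
  have h5 : S.card * (φ ^ 2 / (32 * S.card) * l1 v ^ 2) ≤ φ ^ 2 / 2 * l1On S v ^ 2 := by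
    calc S.card * (φ ^ 2 / (32 * S.card) * l1 v ^ 2) = φ ^ 2 / 32 * l1 v ^ 2 := by
          field_simp
      _ ≤ φ ^ 2 / 32 * (4 * l1On S v) ^ 2 := by gcongr
      _ = _ := by ring
  have h6 := mul_le_mul_of_nonneg_left h2.1 hs.le
  linarith

end Lasso

/-! ### Measurability with respect to the observed history -/

section Selection

lemma sum_selected_eq_sum_indicator {Ω : Type*} {K : ℕ} {I : Ω → Finset (Fin K)}
    (f : Ω → Fin K → ℝ) :
    (fun ω => ∑ k ∈ I ω, f ω k) = fun ω => ∑ k, {ω | k ∈ I ω}.indicator (fun ω => f ω k) ω := by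
  funext ω
  simp [Set.indicator_apply]

variable {Ω : Type*} {K : ℕ} {m : MeasurableSpace Ω} {I : Ω → Finset (Fin K)}

lemma measurableSet_mem_of_fibers (hI : ∀ J, MeasurableSet {ω | I ω = J}) (k : Fin K) :
    MeasurableSet {ω | k ∈ I ω} := by
  have : {ω | k ∈ I ω} = ⋃ J ∈ {J : Finset (Fin K) | k ∈ J}, {ω | I ω = J} := by
    ext ω; simp
  rw [this]
  exact MeasurableSet.biUnion (Set.to_countable _) fun J _ => hI J

lemma measurable_sum_selected (hI : ∀ J, MeasurableSet {ω | I ω = J}) {f : Ω → Fin K → ℝ}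
    (hf : ∀ k, Measurable fun ω => f ω k) : Measurable fun ω => ∑ k ∈ I ω, f ω k := by
  have : (fun ω => ∑ k ∈ I ω, f ω k) = fun ω => ∑ k, if k ∈ I ω then f ω k else 0 := by
    funext ω; simp
  rw [this]
  exact Finset.measurable_sum _ fun k _ =>
    Measurable.ite (measurableSet_mem_of_fibers hI k) (hf k) measurable_const

lemma measurable_ite_mem (hI : ∀ J, MeasurableSet {ω | I ω = J}) {f : Ω → Fin K → ℝ}
    (hf : ∀ k, Measurable fun ω => f ω k) :
    Measurable fun ω k => if k ∈ I ω then f ω k else 0 :=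
  measurable_pi_iff.2 fun k =>
    Measurable.ite (measurableSet_mem_of_fibers hI k) (hf k) measurable_const

lemma abs_sum_selected_le {J : Finset (Fin K)} {L : ℕ} (hJ : J.card = L) {f : Fin K → ℝ} {c : ℝ}
    (hf : ∀ k, |f k| ≤ c) : |∑ k ∈ J, f k| ≤ L * c := by
  refine (Finset.abs_sum_le_sum_abs _ _).trans ((Finset.sum_le_sum fun k _ => hf k).trans_eq ?_)
  rw [Finset.sum_const, hJ, nsmul_eq_mul]

end Selection

section History

variable {Ω : Type*} {K d : ℕ} {R : Run Ω K d} {β : Fin d → ℝ}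

lemma roundSigma_sup_observed_le_postSigma {s t : ℕ} (hs : s ∈ Finset.Icc 1 t) :
    R.roundSigma s ⊔ MeasurableSpace.comap (R.observed β s) inferInstance ≤ R.postSigma β t :=
  le_iSup₂_of_le s hs le_rfl

lemma postSigma_mono {s t : ℕ} (h : s ≤ t) : R.postSigma β s ≤ R.postSigma β t :=
  iSup₂_le fun _ hr => roundSigma_sup_observed_le_postSigma (Finset.Icc_subset_Icc_right h hr)

lemma measurable_X_roundSigma (t : ℕ) : Measurable[R.roundSigma t] (R.X t) :=
  (comap_measurable (R.X t)).mono le_sup_left le_rfl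

lemma measurableSet_sel_roundSigma (t : ℕ) (J : Finset (Fin K)) :
    MeasurableSet[R.roundSigma t] {ω | R.sel t ω = J} :=
  (le_sup_right : MeasurableSpace.comap (R.sel t) ⊤ ≤ R.roundSigma t) _
    ⟨{J}, trivial, by ext ω; simp⟩

lemma measurable_observed_postSigma {s t : ℕ} (hs : s ∈ Finset.Icc 1 t) :
    Measurable[R.postSigma β t] (R.observed β s) :=
  (comap_measurable (R.observed β s)).mono
    (le_sup_right.trans (roundSigma_sup_observed_le_postSigma hs)) le_rfl

lemma roundSigma_le_postSigma {s t : ℕ} (hs : s ∈ Finset.Icc 1 t) :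
    R.roundSigma s ≤ R.postSigma β t :=
  le_sup_left.trans (roundSigma_sup_observed_le_postSigma hs)

/-- The `j`-th coordinate of `∑_{k ∈ I_s} ε_{s,k} X_{s,k}`, the contribution of round `s` to the
correlation of the noise with the design. -/
def noiseTerm (R : Run Ω K d) (j : Fin d) (s : ℕ) (ω : Ω) : ℝ :=
  ∑ k ∈ R.sel s ω, R.noise s ω k * R.X s ω k j

/-- The entry `(i, j)` of `∑_{k ∈ I_s} X_{s,k} X_{s,k}ᵀ`. -/
def gramTerm (R : Run Ω K d) (i j : Fin d) (s : ℕ) (ω : Ω) : ℝ :=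
  ∑ k ∈ R.sel s ω, R.X s ω k i * R.X s ω k j

lemma measurable_X_apply {m : MeasurableSpace Ω} {s : ℕ} (h : Measurable (R.X s)) (k : Fin K)
    (i : Fin d) : Measurable fun ω => R.X s ω k i :=
  (measurable_pi_apply i).comp ((measurable_pi_apply k).comp h)

lemma measurable_dotProduct {m : MeasurableSpace Ω} {s : ℕ} (h : Measurable (R.X s)) (k : Fin K)
    (v : Fin d → ℝ) : Measurable fun ω => R.X s ω k ⬝ᵥ v :=
  Finset.measurable_sum _ fun i _ => (measurable_X_apply h k i).mul_const _

lemma measurable_gramTerm_roundSigma (i j : Fin d) (s : ℕ) :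
    Measurable[R.roundSigma s] (gramTerm R i j s) :=
  measurable_sum_selected (measurableSet_sel_roundSigma s) fun k =>
    (measurable_X_apply (measurable_X_roundSigma s) k i).mul
      (measurable_X_apply (measurable_X_roundSigma s) k j)

/-- The noise of the selected arms can be computed from the observed rewards and the features. -/
lemma measurable_noiseTerm_postSigma (β : Fin d → ℝ) {s t : ℕ} (hs : s ∈ Finset.Icc 1 t)
    (j : Fin d) : Measurable[R.postSigma β t] (noiseTerm R j s) := by
  have e : noiseTerm R j s = fun ω =>
      ∑ k ∈ R.sel s ω, (R.observed β s ω k - R.X s ω k ⬝ᵥ β) * R.X s ω k j := by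
    funext ω
    refine Finset.sum_congr rfl fun k hk => ?_
    rw [Run.observed, if_pos hk, Run.reward]
    ring
  have hX : Measurable[R.postSigma β t] (R.X s) :=
    (measurable_X_roundSigma s).mono (roundSigma_le_postSigma hs) le_rfl
  rw [e]
  refine measurable_sum_selected
    (fun J => roundSigma_le_postSigma hs _ (measurableSet_sel_roundSigma s J)) fun k => ?_
  exact (((measurable_pi_apply k).comp (measurable_observed_postSigma hs)).sub
    (measurable_dotProduct hX k β)).mul (measurable_X_apply hX k j)

/-- The empirical Gram matrix of the `L n` selected features of the rounds `1, …, n`. -/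
noncomputable def empiricalGram (R : Run Ω K d) (L n : ℕ) (ω : Ω) : Matrix (Fin d) (Fin d) ℝ :=
  Matrix.of fun i j => (1 / ((L : ℝ) * n)) * ∑ s ∈ Finset.Icc 1 n, gramTerm R i j s ω

lemma quadratic_form_empiricalGram (L n : ℕ) (ω : Ω) (v : Fin d → ℝ) :
    v ⬝ᵥ (empiricalGram R L n ω *ᵥ v)
      = 1 / ((L : ℝ) * n) * ∑ s ∈ Finset.Icc 1 n, ∑ k ∈ R.sel s ω, (R.X s ω k ⬝ᵥ v) ^ 2 := by
  have h : ∀ x : Fin d → ℝ, (x ⬝ᵥ v) ^ 2 = ∑ i, ∑ j, x i * x j * v j * v i := by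
    intro x
    rw [sq, dotProduct, Finset.sum_mul_sum]
    exact Finset.sum_congr rfl fun _ _ => Finset.sum_congr rfl fun _ _ => by ring
  rw [dotProduct_mulVec_eq_sum]
  simp only [empiricalGram, gramTerm, Matrix.of_apply, h, Finset.mul_sum, Finset.sum_mul]
  have hcomm : ∀ G : Fin d → Fin d → ℕ → Fin K → ℝ,
      ∑ i, ∑ j, ∑ s ∈ Finset.Icc 1 n, ∑ k ∈ R.sel s ω, G i j s k
        = ∑ s ∈ Finset.Icc 1 n, ∑ k ∈ R.sel s ω, ∑ i, ∑ j, G i j s k := by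
    intro G
    calc _ = ∑ i, ∑ s ∈ Finset.Icc 1 n, ∑ k ∈ R.sel s ω, ∑ j, G i j s k := by
          refine Finset.sum_congr rfl fun i _ => ?_
          rw [Finset.sum_comm]
          exact Finset.sum_congr rfl fun s _ => Finset.sum_comm
      _ = _ := by
          rw [Finset.sum_comm]
          exact Finset.sum_congr rfl fun s _ => Finset.sum_comm
  rw [hcomm]
  refine Finset.sum_congr rfl fun _ _ => Finset.sum_congr rfl fun _ _ =>
    Finset.sum_congr rfl fun _ _ => Finset.sum_congr rfl fun _ _ => by ring

end History

section GreedyRun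

variable {Ω : Type*} [m0 : MeasurableSpace Ω] {μ : Measure Ω} {K d L T : ℕ} {xmax σ : ℝ}
  {R : Run Ω K d} {β : Fin d → ℝ}

lemma roundSigma_le (hR : IsGreedyLassoRun μ xmax σ L T β R) {t : ℕ} (ht : t ∈ Finset.Icc 1 T) :
    R.roundSigma t ≤ m0 := by
  refine sup_le (hR.measurable_X t ht).comap_le ?_
  rintro _ ⟨A, -, rfl⟩
  have : R.sel t ⁻¹' A = ⋃ J ∈ A, {ω | R.sel t ω = J} := by ext ω; simp
  rw [this]
  exact MeasurableSet.biUnion (Set.to_countable _) fun J _ => hR.measurableSet_sel t ht J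

lemma postSigma_le (hR : IsGreedyLassoRun μ xmax σ L T β R) {t : ℕ} (ht : t ≤ T) :
    R.postSigma β t ≤ m0 := by
  refine iSup₂_le fun s hs => ?_
  have hs' := Finset.Icc_subset_Icc_right ht hs
  refine sup_le (roundSigma_le hR hs') (Measurable.comap_le ?_)
  refine measurable_pi_iff.2 fun k => Measurable.ite
    (measurableSet_mem_of_fibers (hR.measurableSet_sel s hs') k) ?_ measurable_const
  exact (measurable_dotProduct (hR.measurable_X s hs') k β).add
    ((measurable_pi_apply k).comp (hR.measurable_noise s hs'))

lemma preSigma_le (hR : IsGreedyLassoRun μ xmax σ L T β R) {t : ℕ} (ht : t ∈ Finset.Icc 1 T) :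
    R.preSigma β t ≤ m0 :=
  sup_le (postSigma_le hR (by have := Finset.mem_Icc.1 ht; omega)) (roundSigma_le hR ht)

lemma ae_card_sel (hR : IsGreedyLassoRun μ xmax σ L T β R) {t : ℕ} (ht : t ∈ Finset.Icc 1 T) :
    ∀ᵐ ω ∂μ, (R.sel t ω).card = L := by
  filter_upwards [hR.greedy t ht] with ω hω using hω.1

/-! ### The noise -/

lemma setIntegral_exp_noise_le [IsProbabilityMeasure μ] (hR : IsGreedyLassoRun μ xmax σ L T β R)
    {t : ℕ} (ht : t ∈ Finset.Icc 1 T) (l : Fin K → ℝ) {A : Set Ω}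
    (hA : MeasurableSet[R.preSigma β t] A) :
    ∫ ω in A, Real.exp (∑ k, l k * R.noise t ω k) ∂μ
      ≤ Real.exp (σ ^ 2 * (∑ k, l k ^ 2) / 2) * μ.real A := by
  rw [← setIntegral_condExp (preSigma_le hR ht) (hR.integrable_exp t ht l) hA]
  refine (integral_mono_ae integrable_condExp.integrableOn
    (integrable_const (Real.exp (σ ^ 2 * (∑ k, l k ^ 2) / 2))).integrableOn
    (ae_restrict_of_ae (hR.subGaussian t ht l))).trans_eq ?_
  simp [mul_comm]

lemma integrable_exp_mul_noise (hR : IsGreedyLassoRun μ xmax σ L T β R)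
    {t : ℕ} (ht : t ∈ Finset.Icc 1 T) (k : Fin K) (θ : ℝ) :
    Integrable (fun ω => Real.exp (θ * R.noise t ω k)) μ := by
  simpa [Pi.single_apply] using hR.integrable_exp t ht (Pi.single k θ)

lemma integrable_noise (hR : IsGreedyLassoRun μ xmax σ L T β R)
    {t : ℕ} (ht : t ∈ Finset.Icc 1 T) (k : Fin K) :
    Integrable (fun ω => R.noise t ω k) μ := by
  refine ((integrable_exp_mul_noise hR ht k 1).add (integrable_exp_mul_noise hR ht k (-1))).mono'
    ((measurable_pi_apply k).comp (hR.measurable_noise t ht)).aestronglyMeasurable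
    (ae_of_all _ fun ω => ?_)
  simp only [Pi.add_apply, one_mul, neg_mul, Real.norm_eq_abs]
  have h1 := Real.add_one_le_exp (R.noise t ω k)
  have h2 := Real.add_one_le_exp (-R.noise t ω k)
  have h3 := Real.exp_pos (R.noise t ω k)
  have h4 := Real.exp_pos (-R.noise t ω k)
  exact abs_le.2 ⟨by linarith, by linarith⟩

/-- Sub-Gaussian noise is conditionally centred. -/
lemma setIntegral_noise_eq_zero [IsProbabilityMeasure μ]
    (hR : IsGreedyLassoRun μ xmax σ L T β R) {t : ℕ} (ht : t ∈ Finset.Icc 1 T) (k : Fin K)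
    {A : Set Ω} (hA : MeasurableSet[R.preSigma β t] A) :
    ∫ ω in A, R.noise t ω k ∂μ = 0 := by
  refine eq_zero_of_forall_add_mul_le_exp (p := μ.real A) (c := σ ^ 2 / 2) fun θ => ?_
  have h1 := setIntegral_exp_noise_le hR ht (Pi.single k θ) hA
  have e : ∀ ω, ∑ k', (Pi.single k θ : Fin K → ℝ) k' * R.noise t ω k' = θ * R.noise t ω k :=
    fun ω => by simp [Pi.single_apply]
  have e' : ∑ k', (Pi.single k θ : Fin K → ℝ) k' ^ 2 = θ ^ 2 := by simp [Pi.single_apply]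
  simp only [e, e'] at h1
  have h2 : ∫ ω in A, (1 + θ * R.noise t ω k) ∂μ ≤ ∫ ω in A, Real.exp (θ * R.noise t ω k) ∂μ :=
    integral_mono ((integrable_const 1).add ((integrable_noise hR ht k).const_mul θ)).integrableOn
      (integrable_exp_mul_noise hR ht k θ).integrableOn fun ω => by
        have := Real.add_one_le_exp (θ * R.noise t ω k)
        simp only
        linarith
  rw [integral_add (integrable_const _) ((integrable_noise hR ht k).const_mul θ).integrableOn,
    integral_const_mul] at h2
  simp only [integral_const, MeasurableSet.univ, measureReal_restrict_apply, Set.univ_inter,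
    smul_eq_mul, mul_one] at h2
  refine h2.trans (h1.trans_eq ?_)
  ring_nf

lemma integrable_sum_selected_noise (hR : IsGreedyLassoRun μ xmax σ L T β R) {t : ℕ}
    (ht : t ∈ Finset.Icc 1 T) {I : Ω → Finset (Fin K)}
    (hI : ∀ J, MeasurableSet {ω | I ω = J}) :
    Integrable (fun ω => ∑ k ∈ I ω, R.noise t ω k) μ := by
  rw [sum_selected_eq_sum_indicator]
  exact integrable_finsetSum _ fun k _ =>
    (integrable_noise hR ht k).indicator (measurableSet_mem_of_fibers hI k)

lemma integral_sum_selected_noise [IsProbabilityMeasure μ]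
    (hR : IsGreedyLassoRun μ xmax σ L T β R) {t : ℕ}
    (ht : t ∈ Finset.Icc 1 T) {I : Ω → Finset (Fin K)}
    (hI : ∀ J, MeasurableSet[R.preSigma β t] {ω | I ω = J}) :
    ∫ ω, ∑ k ∈ I ω, R.noise t ω k ∂μ = 0 := by
  have hI' : ∀ k, MeasurableSet {ω | k ∈ I ω} := fun k =>
    preSigma_le hR ht _ (measurableSet_mem_of_fibers hI k)
  rw [sum_selected_eq_sum_indicator,
    integral_finsetSum _ fun k _ => (integrable_noise hR ht k).indicator (hI' k)]
  refine Finset.sum_eq_zero fun k _ => ?_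
  rw [integral_indicator (hI' k)]
  exact setIntegral_noise_eq_zero hR ht k (measurableSet_mem_of_fibers hI k)

lemma isCondSubgaussian_noiseTerm [IsProbabilityMeasure μ]
    (hR : IsGreedyLassoRun μ xmax σ L T β R) {t : ℕ} (ht : t ∈ Finset.Icc 1 T) (j : Fin d) :
    IsCondSubgaussian (R.preSigma β t) μ (noiseTerm R j t) (σ ^ 2 * (L * xmax ^ 2)) := by
  intro θ g hg
  set l : Ω → Fin K → ℝ := fun ω k => if k ∈ R.sel t ω then θ * R.X t ω k j else 0 with hl
  have hround : R.roundSigma t ≤ R.preSigma β t := le_sup_right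
  have hlm : Measurable[R.preSigma β t] l :=
    measurable_ite_mem (fun J => hround _ (measurableSet_sel_roundSigma t J)) fun k =>
      (measurable_X_apply ((measurable_X_roundSigma t).mono hround le_rfl) k j).const_mul θ
  have hε := hR.measurable_noise t ht
  refine le_trans (lintegral_mono_ae ?_) (lintegral_mul_exp_random_coeff_le (σ := σ)
    (preSigma_le hR ht) hε (fun l g hg => ?_) hlm hg)
  · filter_upwards [ae_card_sel hR ht, hR.bounded t ht] with ω hcard hb
    refine mul_le_mul_right (ENNReal.ofReal_le_ofReal (Real.exp_le_exp.2 ?_)) _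
    have h1 : ∑ k, l ω k * R.noise t ω k = θ * noiseTerm R j t ω := by
      simp only [hl, ite_mul, zero_mul, Finset.sum_ite_mem, Finset.univ_inter, noiseTerm,
        Finset.mul_sum]
      exact Finset.sum_congr rfl fun _ _ => by ring
    have h2 : ∑ k, l ω k ^ 2 ≤ θ ^ 2 * (L * xmax ^ 2) := by
      calc ∑ k, l ω k ^ 2 = ∑ k ∈ R.sel t ω, (θ * R.X t ω k j) ^ 2 := by
            simp only [hl, ite_pow, ne_eq, OfNat.ofNat_ne_zero, not_false_eq_true, zero_pow,
              Finset.sum_ite_mem, Finset.univ_inter]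
        _ ≤ ∑ k ∈ R.sel t ω, θ ^ 2 * xmax ^ 2 := by
            refine Finset.sum_le_sum fun k _ => ?_
            rw [mul_pow]
            exact mul_le_mul_of_nonneg_left
              (sq_le_sq' (abs_le.1 (hb k j)).1 (abs_le.1 (hb k j)).2) (sq_nonneg _)
        _ = θ ^ 2 * (L * xmax ^ 2) := by rw [Finset.sum_const, hcard, nsmul_eq_mul]; ring
    rw [h1]
    have h3 := mul_le_mul_of_nonneg_left h2 (sq_nonneg σ)
    linarith
  · refine lintegral_mul_exp_sub_le (preSigma_le hR ht) (by fun_prop) (hR.integrable_exp t ht l)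
      (fun A hA => setIntegral_exp_noise_le hR ht l hA) hg

lemma measurable_noiseTerm (hR : IsGreedyLassoRun μ xmax σ L T β R) {t : ℕ}
    (ht : t ∈ Finset.Icc 1 T) (j : Fin d) : Measurable (noiseTerm R j t) :=
  (measurable_noiseTerm_postSigma β (Finset.right_mem_Icc.2 (Finset.mem_Icc.1 ht).1) j).mono
    (postSigma_le hR (Finset.mem_Icc.1 ht).2) le_rfl

/-- The event that the penalty of the LASSO after round `n` does not dominate the noise. -/
def noiseEvent (R : Run Ω K d) (xmax σ : ℝ) (L n : ℕ) : Set Ω :=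
  {ω | ∃ j, (L : ℝ) * n * lassoLam xmax σ d L n / 4 ≤ |∑ s ∈ Finset.Icc 1 n, noiseTerm R j s ω|}

lemma measurableSet_noiseEvent (hR : IsGreedyLassoRun μ xmax σ L T β R) {n : ℕ} (hn : n ≤ T) :
    MeasurableSet (noiseEvent R xmax σ L n) := by
  rw [noiseEvent, Set.ofPred_exists]
  refine MeasurableSet.iUnion fun j => measurableSet_le measurable_const ?_
  have : Measurable fun ω => ∑ s ∈ Finset.Icc 1 n, noiseTerm R j s ω :=
    Finset.measurable_sum _ fun s hs =>
      measurable_noiseTerm hR (Finset.Icc_subset_Icc_right hn hs) j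
  exact this.abs

/-- The regularization parameter is calibrated so that each of the `d` coordinates contributes
`2 exp (-(2 log (L n) + log d))`. -/
lemma measure_noiseEvent_le [IsProbabilityMeasure μ] (hR : IsGreedyLassoRun μ xmax σ L T β R)
    (hσ : 0 < σ) (hx : 0 < xmax) (hL : 1 ≤ L) (hd : 1 ≤ d) {n : ℕ} (hn : n ∈ Finset.Icc 1 T) :
    μ.real (noiseEvent R xmax σ L n) ≤ 2 / (L : ℝ) ^ 2 * (1 / (n : ℝ) ^ 2) := by
  obtain ⟨hn1, hnT⟩ := Finset.mem_Icc.1 hn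
  have hL0 : (0 : ℝ) < L := by exact_mod_cast hL
  have hd0 : (0 : ℝ) < d := by exact_mod_cast hd
  have hn0 : (0 : ℝ) < n := by exact_mod_cast hn1
  have hN1 : (1 : ℝ) ≤ L * n := by exact_mod_cast Nat.mul_pos hL hn1
  have hlogN : 0 ≤ Real.log (L * n) := Real.log_nonneg hN1
  have hlogd : 0 ≤ Real.log d := Real.log_nonneg (by exact_mod_cast hd)
  have hsub : ∀ s ∈ Finset.Icc 1 n, s ∈ Finset.Icc 1 T := fun s hs =>
    Finset.Icc_subset_Icc_right hnT hs
  have hlam0 : 0 ≤ lassoLam xmax σ d L n := by unfold lassoLam; positivity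
  have hexp : Real.exp (-((L * n * lassoLam xmax σ d L n / 4) ^ 2 /
      (2 * n * (σ ^ 2 * (L * xmax ^ 2))))) = 1 / ((L * n) ^ 2 * d) := by
    have hsq : (L * n * lassoLam xmax σ d L n / 4) ^ 2 / (2 * n * (σ ^ 2 * (L * xmax ^ 2)))
        = Real.log ((L * n) ^ 2 * d) := by
      rw [Real.log_mul (by positivity) (by positivity), Real.log_pow]
      unfold lassoLam
      have : √((4 * Real.log (L * n) + 2 * Real.log d) / (L * n)) ^ 2
          = (4 * Real.log (L * n) + 2 * Real.log d) / (L * n) := Real.sq_sqrt (by positivity)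
      rw [show (L * n * (4 * xmax * σ * √((4 * Real.log (L * n) + 2 * Real.log d) / (L * n))) / 4)
          ^ 2 = (L * n * xmax * σ) ^ 2 *
            √((4 * Real.log (L * n) + 2 * Real.log d) / (L * n)) ^ 2 by ring, this]
      push_cast
      field_simp
      ring
    rw [hsq, Real.exp_neg, Real.exp_log (by positivity), one_div]
  have hone : ∀ j, μ.real {ω | (L : ℝ) * n * lassoLam xmax σ d L n / 4
      ≤ |∑ s ∈ Finset.Icc 1 n, noiseTerm R j s ω|} ≤ 2 * (1 / ((L * n) ^ 2 * d)) := by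
    intro j
    rw [← hexp]
    refine measure_abs_sum_ge_le hn1 (F := fun s => R.preSigma β s) (by positivity)
      (fun s hs => isCondSubgaussian_noiseTerm hR (hsub s hs) j) (fun s _ r hr => ?_)
      (fun s hs => measurable_noiseTerm hR (hsub s hs) j) (by positivity)
    exact (measurable_noiseTerm_postSigma β hr j).mono le_sup_left le_rfl
  calc μ.real (noiseEvent R xmax σ L n)
      ≤ ∑ j : Fin d, μ.real {ω | (L : ℝ) * n * lassoLam xmax σ d L n / 4
          ≤ |∑ s ∈ Finset.Icc 1 n, noiseTerm R j s ω|} := by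
        rw [noiseEvent, Set.ofPred_exists]
        exact measureReal_iUnion_fintype_le _
    _ ≤ ∑ _j : Fin d, 2 * (1 / ((L * n : ℝ) ^ 2 * d)) := Finset.sum_le_sum fun j _ => hone j
    _ = 2 / (L : ℝ) ^ 2 * (1 / (n : ℝ) ^ 2) := by
        rw [Finset.sum_const, Finset.card_univ, Fintype.card_fin, nsmul_eq_mul]
        field_simp

/-! ### The empirical Gram matrix -/

/-- The deviation of `gramTerm` from its conditional mean given the preceding rounds. -/
noncomputable def gramDev (R : Run Ω K d) (μ : Measure Ω) (β : Fin d → ℝ) (i j : Fin d)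
    (s : ℕ) (ω : Ω) : ℝ :=
  gramTerm R i j s ω - (μ[gramTerm R i j s | R.postSigma β (s - 1)]) ω

lemma empiricalGram_sub_expectedGram (L n : ℕ) (ω : Ω) (i j : Fin d) :
    empiricalGram R L n ω i j - R.expectedGram μ β L n ω i j
      = 1 / ((L : ℝ) * n) * ∑ s ∈ Finset.Icc 1 n, gramDev R μ β i j s ω := by
  simp only [empiricalGram, Run.expectedGram, Matrix.of_apply, gramDev, Finset.sum_sub_distrib,
    mul_sub]
  rfl

lemma ae_abs_gramTerm_le (hR : IsGreedyLassoRun μ xmax σ L T β R) (hx : 0 < xmax)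
    {s : ℕ} (hs : s ∈ Finset.Icc 1 T) (i j : Fin d) :
    ∀ᵐ ω ∂μ, |gramTerm R i j s ω| ≤ L * xmax ^ 2 := by
  filter_upwards [ae_card_sel hR hs, hR.bounded s hs] with ω hcard hb
  refine abs_sum_selected_le hcard fun k => ?_
  rw [abs_mul, sq]
  exact mul_le_mul (hb k i) (hb k j) (abs_nonneg _) hx.le

lemma measurable_gramDev_postSigma {s t : ℕ} (hs : s ∈ Finset.Icc 1 t) (i j : Fin d) :
    Measurable[R.postSigma β t] (gramDev R μ β i j s) :=
  ((measurable_gramTerm_roundSigma i j s).mono (roundSigma_le_postSigma hs) le_rfl).sub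
    (stronglyMeasurable_condExp.measurable.mono
      (postSigma_mono (by have := Finset.mem_Icc.1 hs; omega)) le_rfl)

lemma measurable_gramDev (hR : IsGreedyLassoRun μ xmax σ L T β R)
    {s : ℕ} (hs : s ∈ Finset.Icc 1 T) (i j : Fin d) : Measurable (gramDev R μ β i j s) :=
  (measurable_gramDev_postSigma hs i j).mono (postSigma_le hR le_rfl) le_rfl

lemma isCondSubgaussian_gramDev [IsProbabilityMeasure μ]
    (hR : IsGreedyLassoRun μ xmax σ L T β R) (hx : 0 < xmax) (hL : 1 ≤ L) {s : ℕ}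
    (hs : s ∈ Finset.Icc 1 T) (i j : Fin d) :
    IsCondSubgaussian (R.postSigma β (s - 1)) μ (gramDev R μ β i j s)
      ((2 * (L * xmax ^ 2)) ^ 2) := by
  have hm : R.postSigma β (s - 1) ≤ m0 :=
    postSigma_le hR (by have := Finset.mem_Icc.1 hs; omega)
  have hL0 : (0 : ℝ) < L := by exact_mod_cast hL
  have hbound := ae_abs_gramTerm_le hR hx hs i j
  have hmeas : Measurable (gramTerm R i j s) :=
    (measurable_gramTerm_roundSigma i j s).mono (roundSigma_le hR hs) le_rfl
  have hint : Integrable (gramTerm R i j s) μ :=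
    Integrable.of_bound hmeas.aestronglyMeasurable _ hbound
  refine isCondSubgaussian_of_bounded hm (measurable_gramDev hR hs i j) (by positivity) ?_ ?_
  · have hc : ∀ᵐ ω ∂μ, |(μ[gramTerm R i j s | R.postSigma β (s - 1)]) ω| ≤ L * xmax ^ 2 :=
      ae_bdd_abs_condExp_of_ae_bdd_abs hbound
    filter_upwards [hbound, hc] with ω h1 h2
    have := abs_sub (gramTerm R i j s ω) ((μ[gramTerm R i j s | R.postSigma β (s - 1)]) ω)
    unfold gramDev
    linarith
  · intro A hA
    unfold gramDev
    rw [integral_sub hint.integrableOn integrable_condExp.integrableOn,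
      setIntegral_condExp hm hint hA, sub_self]

/-- The event that the empirical Gram matrix after round `n` is, in some entry, `δ`-far from the
expected one. -/
def gramEvent (R : Run Ω K d) (μ : Measure Ω) (β : Fin d → ℝ) (δ : ℝ) (L n : ℕ) : Set Ω :=
  {ω | ∃ i j, δ ≤ |empiricalGram R L n ω i j - R.expectedGram μ β L n ω i j|}

lemma gramEvent_eq (hL : 1 ≤ L) {n : ℕ} (hn : 1 ≤ n) (δ : ℝ) :
    gramEvent R μ β δ L n
      = ⋃ i, ⋃ j, {ω | L * n * δ ≤ |∑ s ∈ Finset.Icc 1 n, gramDev R μ β i j s ω|} := by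
  have hN : (0 : ℝ) < L * n := by exact_mod_cast Nat.mul_pos hL hn
  ext ω
  simp only [gramEvent, empiricalGram_sub_expectedGram, Set.mem_ofPred_eq, Set.mem_iUnion]
  refine exists_congr fun i => exists_congr fun j => ?_
  rw [abs_mul, abs_of_pos (one_div_pos.2 hN), one_div_mul_eq_div, le_div_iff₀ hN, mul_comm]

lemma measurableSet_gramEvent (hR : IsGreedyLassoRun μ xmax σ L T β R) (hL : 1 ≤ L) {n : ℕ}
    (hn : n ∈ Finset.Icc 1 T) (δ : ℝ) : MeasurableSet (gramEvent R μ β δ L n) := by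
  obtain ⟨hn1, hnT⟩ := Finset.mem_Icc.1 hn
  rw [gramEvent_eq hL hn1]
  refine MeasurableSet.iUnion fun i => MeasurableSet.iUnion fun j =>
    measurableSet_le measurable_const ?_
  have : Measurable fun ω => ∑ s ∈ Finset.Icc 1 n, gramDev R μ β i j s ω :=
    Finset.measurable_sum _ fun s hs =>
      measurable_gramDev hR (Finset.Icc_subset_Icc_right hnT hs) i j
  exact this.abs

lemma measure_gramEvent_le [IsProbabilityMeasure μ] (hR : IsGreedyLassoRun μ xmax σ L T β R)
    (hx : 0 < xmax) (hL : 1 ≤ L) {n : ℕ} (hn : n ∈ Finset.Icc 1 T) {δ : ℝ} (hδ : 0 ≤ δ) :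
    μ.real (gramEvent R μ β δ L n)
      ≤ 2 * (d : ℝ) ^ 2 * Real.exp (-(8 * (δ / (8 * xmax ^ 2)) ^ 2 * n)) := by
  obtain ⟨hn1, hnT⟩ := Finset.mem_Icc.1 hn
  have hL0 : (0 : ℝ) < L := by exact_mod_cast hL
  have hn0 : (0 : ℝ) < n := by exact_mod_cast hn1
  have hsub : ∀ s ∈ Finset.Icc 1 n, s ∈ Finset.Icc 1 T := fun s hs =>
    Finset.Icc_subset_Icc_right hnT hs
  have hone : ∀ i j, μ.real {ω | L * n * δ ≤ |∑ s ∈ Finset.Icc 1 n, gramDev R μ β i j s ω|}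
      ≤ 2 * Real.exp (-(8 * (δ / (8 * xmax ^ 2)) ^ 2 * n)) := by
    intro i j
    have e : 8 * (δ / (8 * xmax ^ 2)) ^ 2 * n
        = (L * n * δ) ^ 2 / (2 * n * (2 * (L * xmax ^ 2)) ^ 2) := by
      field_simp
      ring
    rw [e]
    refine measure_abs_sum_ge_le hn1 (F := fun s => R.postSigma β (s - 1)) (by positivity)
      (fun s hs => isCondSubgaussian_gramDev hR hx hL (hsub s hs) i j) (fun s _ r hr => ?_)
      (fun s hs => measurable_gramDev hR (hsub s hs) i j) (by positivity)
    exact measurable_gramDev_postSigma hr i j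
  rw [gramEvent_eq hL hn1]
  calc _ ≤ ∑ i : Fin d, ∑ j : Fin d,
          μ.real {ω | L * n * δ ≤ |∑ s ∈ Finset.Icc 1 n, gramDev R μ β i j s ω|} :=
        (measureReal_iUnion_fintype_le _).trans
          (Finset.sum_le_sum fun i _ => measureReal_iUnion_fintype_le _)
    _ ≤ ∑ _i : Fin d, ∑ _j : Fin d, 2 * Real.exp (-(8 * (δ / (8 * xmax ^ 2)) ^ 2 * n)) :=
        Finset.sum_le_sum fun i _ => Finset.sum_le_sum fun j _ => hone i j
    _ = _ := by
        simp only [Finset.sum_const, Finset.card_univ, Fintype.card_fin, nsmul_eq_mul]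
        ring

end GreedyRun

/-! ### Regret of a single round -/

lemma abs_dotProduct_le_mul_l1 {d : ℕ} {x v : Fin d → ℝ} {c : ℝ} (h : ∀ i, |x i| ≤ c) :
    |x ⬝ᵥ v| ≤ c * l1 v :=
  abs_sum_mul_le h

/-- A greedy set has the largest total score among all sets of its size: its scores dominate those
of the other arms, and the two differences have equal size. -/
lemma IsGreedySet.sum_le_sum {K d L : ℕ} {x : Fin K → Fin d → ℝ} {v : Fin d → ℝ}
    {I J : Finset (Fin K)} (hI : IsGreedySet L x v I) (hJ : J.card = L) :
    ∑ k ∈ J, x k ⬝ᵥ v ≤ ∑ k ∈ I, x k ⬝ᵥ v := by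
  have hcard : (J \ I).card = (I \ J).card := Finset.card_sdiff_comm (hJ.trans hI.1.symm)
  have hdiff : ∑ k ∈ J \ I, x k ⬝ᵥ v ≤ ∑ k ∈ I \ J, x k ⬝ᵥ v := by
    rcases (I \ J).eq_empty_or_nonempty with h | h
    · rw [h, Finset.card_empty, Finset.card_eq_zero] at hcard
      rw [h, hcard]
    · obtain ⟨i, hi, hmin⟩ := Finset.exists_min_image (I \ J) (fun k => x k ⬝ᵥ v) h
      calc ∑ k ∈ J \ I, x k ⬝ᵥ v ≤ (J \ I).card • (x i ⬝ᵥ v) :=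
            Finset.sum_le_card_nsmul _ _ _ fun j hj =>
              hI.2 i (Finset.mem_sdiff.1 hi).1 j (Finset.mem_sdiff.1 hj).2
        _ = (I \ J).card • (x i ⬝ᵥ v) := by rw [hcard]
        _ ≤ ∑ k ∈ I \ J, x k ⬝ᵥ v := Finset.card_nsmul_le_sum _ _ _ hmin
  rw [← Finset.sum_inter_add_sum_sdiff J I, ← Finset.sum_inter_add_sum_sdiff I J,
    Finset.inter_comm I J]
  linarith

/-- The mean regret of a greedy set is bounded by the error of the parameter estimate. -/
lemma IsGreedySet.regret_le {K d L : ℕ} {x : Fin K → Fin d → ℝ} {v β : Fin d → ℝ} {c : ℝ}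
    (hx : ∀ k i, |x k i| ≤ c) {I J : Finset (Fin K)} (hI : IsGreedySet L x v I)
    (hJ : J.card = L) :
    ∑ k ∈ J, x k ⬝ᵥ β - ∑ k ∈ I, x k ⬝ᵥ β ≤ 2 * L * c * l1 (v - β) := by
  have h1 := abs_le.1 (abs_sum_selected_le hJ fun k => abs_dotProduct_le_mul_l1 (v := v - β) (hx k))
  have h2 := abs_le.1
    (abs_sum_selected_le hI.1 fun k => abs_dotProduct_le_mul_l1 (v := v - β) (hx k))
  simp only [dotProduct_sub, Finset.sum_sub_distrib] at h1 h2
  have h3 := hI.sum_le_sum hJ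
  linarith [h1.1, h2.2]

section GreedyRun

variable {Ω : Type*} [m0 : MeasurableSpace Ω] {μ : Measure Ω} {K d L T : ℕ} {xmax σ : ℝ}
  {R : Run Ω K d} {β : Fin d → ℝ} {opt : ℕ → Ω → Finset (Fin K)}

/-- The mean regret of round `t`, in which the noise is left out. -/
def meanGap (R : Run Ω K d) (β : Fin d → ℝ) (opt : ℕ → Ω → Finset (Fin K)) (t : ℕ) (ω : Ω) : ℝ :=
  ∑ k ∈ opt t ω, R.X t ω k ⬝ᵥ β - ∑ k ∈ R.sel t ω, R.X t ω k ⬝ᵥ β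

lemma measurableSet_opt_preSigma (hopt : IsOptimalSelection μ L T β R opt) {t : ℕ}
    (ht : t ∈ Finset.Icc 1 T) (J : Finset (Fin K)) :
    MeasurableSet[R.preSigma β t] {ω | opt t ω = J} :=
  (le_sup_left.trans le_sup_right :
    MeasurableSpace.comap (R.X t) inferInstance ≤ R.preSigma β t) _ (hopt.measurableSet_opt t ht J)

lemma ae_abs_meanGap_le (hR : IsGreedyLassoRun μ xmax σ L T β R)
    (hopt : IsOptimalSelection μ L T β R opt) {t : ℕ} (ht : t ∈ Finset.Icc 1 T) :
    ∀ᵐ ω ∂μ, |meanGap R β opt t ω| ≤ 2 * L * xmax * l1 β := by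
  filter_upwards [ae_card_sel hR ht, hopt.optimal t ht, hR.bounded t ht] with ω h1 h2 hb
  have h3 := abs_sum_selected_le h1 fun k => abs_dotProduct_le_mul_l1 (v := β) (hb k)
  have h4 := abs_sum_selected_le h2.1 fun k => abs_dotProduct_le_mul_l1 (v := β) (hb k)
  have h5 := abs_sub (∑ k ∈ opt t ω, R.X t ω k ⬝ᵥ β) (∑ k ∈ R.sel t ω, R.X t ω k ⬝ᵥ β)
  unfold meanGap
  linarith

lemma integrable_meanGap [IsProbabilityMeasure μ] (hR : IsGreedyLassoRun μ xmax σ L T β R)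
    (hopt : IsOptimalSelection μ L T β R opt) {t : ℕ} (ht : t ∈ Finset.Icc 1 T) :
    Integrable (meanGap R β opt t) μ := by
  refine Integrable.of_bound (Measurable.aestronglyMeasurable ?_) _ (ae_abs_meanGap_le hR hopt ht)
  have hX := fun k => measurable_dotProduct (hR.measurable_X t ht) k β
  exact (measurable_sum_selected (fun J => preSigma_le hR ht _
    (measurableSet_opt_preSigma hopt ht J)) hX).sub
      (measurable_sum_selected (hR.measurableSet_sel t ht) hX)

/-- The noise does not contribute to the expected regret: both the selected and the optimal set are
measurable with respect to `ℱ_t`. -/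
lemma integral_reward_sub_eq [IsProbabilityMeasure μ] (hR : IsGreedyLassoRun μ xmax σ L T β R)
    (hopt : IsOptimalSelection μ L T β R opt) {t : ℕ} (ht : t ∈ Finset.Icc 1 T) :
    ∫ ω, (∑ k ∈ opt t ω, R.reward β t ω k - ∑ k ∈ R.sel t ω, R.reward β t ω k) ∂μ
      = ∫ ω, meanGap R β opt t ω ∂μ := by
  have hround : R.roundSigma t ≤ R.preSigma β t := le_sup_right
  have h1 := measurableSet_opt_preSigma (t := t) hopt ht
  have h2 : ∀ J, MeasurableSet[R.preSigma β t] {ω | R.sel t ω = J} :=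
    fun J => hround _ (measurableSet_sel_roundSigma t J)
  have i1 := integrable_sum_selected_noise hR ht fun J => preSigma_le hR ht _ (h1 J)
  have i2 := integrable_sum_selected_noise hR ht fun J => preSigma_le hR ht _ (h2 J)
  have e : ∀ ω, ∑ k ∈ opt t ω, R.reward β t ω k - ∑ k ∈ R.sel t ω, R.reward β t ω k
      = meanGap R β opt t ω
        + (∑ k ∈ opt t ω, R.noise t ω k - ∑ k ∈ R.sel t ω, R.noise t ω k) := by
    intro ω
    simp only [Run.reward, meanGap, Finset.sum_add_distrib]
    ring
  simp only [e]
  have i12 : Integrable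
      (fun ω => ∑ k ∈ opt t ω, R.noise t ω k - ∑ k ∈ R.sel t ω, R.noise t ω k) μ := i1.sub i2
  rw [integral_add (integrable_meanGap hR hopt ht) i12, integral_sub i1 i2,
    integral_sum_selected_noise hR ht h1, integral_sum_selected_noise hR ht h2]
  ring

lemma compl_activeSet_eq_empty_of_lassoLam_eq_zero (hσ : 0 < σ) (hx : 0 < xmax) (hL : 1 ≤ L)
    (hS : 1 ≤ (activeSet β).card) {n : ℕ} (hn : 1 ≤ n) (h : lassoLam xmax σ d L n = 0) :
    (activeSet β)ᶜ = ∅ := by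
  have hSd : (activeSet β).card ≤ d := by simpa using Finset.card_le_univ (activeSet β)
  have hd : 1 ≤ d := hS.trans hSd
  have hN : (1 : ℝ) ≤ L * n := by exact_mod_cast Nat.mul_pos hL hn
  have hlogN : 0 ≤ Real.log (L * n) := Real.log_nonneg hN
  have hlogd : Real.log d ≤ 0 := by
    by_contra! hlog
    have : 0 < lassoLam xmax σ d L n := by
      have hN0 : (0 : ℝ) < L * n := by linarith
      unfold lassoLam
      exact mul_pos (by positivity) (Real.sqrt_pos.2 (by positivity))
    linarith
  have hd1 : d ≤ 1 := by
    by_contra! hd2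
    exact hlogd.not_gt (Real.log_pos (by exact_mod_cast hd2))
  rw [Finset.compl_eq_empty_iff, ← Finset.card_eq_iff_eq_univ, Fintype.card_fin]
  omega

/-- Off the two exceptional events, the oracle inequality applies with compatibility constant
`φ² / 2`. -/
lemma l1_est_sub_le (hσ : 0 < σ) (hx : 0 < xmax) (hL : 1 ≤ L)
    (hS : 1 ≤ (activeSet β).card) {φ : ℝ} (hφ : 0 < φ) {n : ℕ} (hn : 1 ≤ n) {ω : Ω}
    (hcompat : φ < compatConst (activeSet β) (R.expectedGram μ β L n ω))
    (hmin : R.lassoObjective β L n (lassoLam xmax σ d L n) ω (R.est n ω)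
      ≤ R.lassoObjective β L n (lassoLam xmax σ d L n) ω β)
    (hnoise : ω ∉ noiseEvent R xmax σ L n)
    (hgram : ω ∉ gramEvent R μ β (φ ^ 2 / (32 * (activeSet β).card)) L n) :
    l1 (R.est n ω - β) ≤ 8 * (activeSet β).card / φ ^ 2 * lassoLam xmax σ d L n := by
  have hN : (0 : ℝ) < L * n := by exact_mod_cast Nat.mul_pos hL hn
  have hlam0 : 0 ≤ lassoLam xmax σ d L n := by unfold lassoLam; positivity
  simp only [noiseEvent, gramEvent, Set.mem_ofPred_eq, not_exists, not_le] at hnoise hgram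
  have key := l1_lasso_error_le (d := d) ((Finset.Icc 1 n).sigma fun s => R.sel s ω)
    (fun p => R.X p.1 ω p.2) (fun p => R.noise p.1 ω p.2) (N := L * n)
    (lam := lassoLam xmax σ d L n) (c := φ ^ 2 / 2) hN (by positivity) β (R.est n ω) hlam0
    (compl_activeSet_eq_empty_of_lassoLam_eq_zero hσ hx hL hS hn)
    (by
      rw [Finset.sum_sigma, Finset.sum_sigma]
      exact hmin)
    (fun j => by
      rw [Finset.sum_sigma]
      exact (hnoise j).le)
    (fun v hv hcone => by
      rw [Finset.sum_sigma, ← quadratic_form_empiricalGram]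
      exact half_sq_mul_le_of_close hφ hS hcompat (fun i j => (hgram i j).le) hv hcone)
  refine key.trans_eq ?_
  field_simp
  ring

lemma sq_kappa_le {s₀ : ℕ} {φ : ℝ} (hx : 0 < xmax) (hs : 1 ≤ s₀) (hφ : 0 < φ) :
    0 < kappa xmax s₀ φ ∧ (kappa xmax s₀ φ) ^ 2 ≤ 7 / 16 ∧
      (kappa xmax s₀ φ) ^ 2 ≤ (φ ^ 2 / (32 * s₀) / (8 * xmax ^ 2)) ^ 2 := by
  have hs0 : (0 : ℝ) < s₀ := by exact_mod_cast hs
  have h2 : √2 ^ 2 = 2 := Real.sq_sqrt zero_le_two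
  have h2' : 1.41 < √2 := by rw [Real.lt_sqrt (by norm_num)]; norm_num
  have h2'' : √2 < 2 := by rw [Real.sqrt_lt' (by norm_num)]; norm_num
  have hk : 0 < kappa xmax s₀ φ := lt_min (by linarith) (by positivity)
  have hk1 : kappa xmax s₀ φ ≤ 2 - √2 := min_le_left _ _
  refine ⟨hk, by nlinarith, pow_le_pow_left₀ hk.le ((min_le_right _ _).trans_eq ?_) 2⟩
  field_simp
  norm_num

/-- The expected regret of the round after round `n`.  For `n = 0` the minimum is `1`, while
`1 / 0² = 1 / √0 = 0`, so that the right-hand side is the trivial bound `2 L x_max ‖β‖₁`. -/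
lemma integral_meanGap_succ_le [IsProbabilityMeasure μ] (hR : IsGreedyLassoRun μ xmax σ L T β R)
    (hopt : IsOptimalSelection μ L T β R opt) (hσ : 0 < σ) (hx : 0 < xmax) (hL : 1 ≤ L)
    (hS : 1 ≤ (activeSet β).card) {φ : ℝ} (hφ : 0 < φ)
    (hcompat : ∀ᵐ ω ∂μ, ∀ t ∈ Finset.Icc 1 T,
      φ < compatConst (activeSet β) (R.expectedGram μ β L t ω))
    {n : ℕ} (hn : n < T) :
    ∫ ω, meanGap R β opt (n + 1) ω ∂μ ≤ 2 * L * xmax * l1 β *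
        (2 / (L : ℝ) ^ 2 * (1 / (n : ℝ) ^ 2) + min 1 (2 * (d : ℝ) ^ 2 *
          Real.exp (-(8 * (kappa xmax (activeSet β).card φ) ^ 2 * n))))
      + 64 * L * xmax ^ 2 * σ * (activeSet β).card / φ ^ 2 *
        (√(4 * Real.log ((L : ℝ) * T) + 2 * Real.log d) / √L) * (1 / √(n : ℝ)) := by
  have ht : n + 1 ∈ Finset.Icc 1 T := Finset.mem_Icc.2 ⟨by omega, hn⟩
  have hd : 1 ≤ d := hS.trans (by simpa using Finset.card_le_univ (activeSet β))
  have hd1 : (1 : ℝ) ≤ d := by exact_mod_cast hd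
  have hl1 : 0 ≤ l1 β := Finset.sum_nonneg fun _ _ => abs_nonneg _
  have hL0 : (0 : ℝ) < L := by exact_mod_cast hL
  have htriv := ae_abs_meanGap_le hR hopt ht
  rcases Nat.eq_zero_or_pos n with rfl | hn1
  · have hmin : min 1 (2 * (d : ℝ) ^ 2 *
        Real.exp (-(8 * (kappa xmax (activeSet β).card φ) ^ 2 * (0 : ℕ)))) = 1 := by
      simp only [Nat.cast_zero, mul_zero, neg_zero, Real.exp_zero, mul_one]
      exact min_eq_left (by nlinarith)
    rw [hmin]
    calc ∫ ω, meanGap R β opt (0 + 1) ω ∂μ ≤ ∫ _ω, 2 * L * xmax * l1 β ∂μ :=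
          integral_mono_ae (integrable_meanGap hR hopt ht) (integrable_const _)
            (htriv.mono fun ω h => (le_abs_self _).trans h)
      _ = 2 * L * xmax * l1 β := by simp
      _ = _ := by simp
  set N := noiseEvent R xmax σ L n
  set G := gramEvent R μ β (φ ^ 2 / (32 * (activeSet β).card)) L n
  have hnmem : n ∈ Finset.Icc 1 T := Finset.mem_Icc.2 ⟨hn1, hn.le⟩
  have hNm : MeasurableSet N := measurableSet_noiseEvent hR hn.le
  have hGm : MeasurableSet G := measurableSet_gramEvent hR hL hnmem _
  set A := 2 * L * xmax * l1 β
  set B := 2 * L * xmax * (8 * (activeSet β).card / φ ^ 2 * lassoLam xmax σ d L n) with hB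
  have hA0 : 0 ≤ A := by positivity
  have hB0 : 0 ≤ B := by
    have : 0 ≤ lassoLam xmax σ d L n := by unfold lassoLam; positivity
    positivity
  have hpt : ∀ᵐ ω ∂μ, meanGap R β opt (n + 1) ω
      ≤ N.indicator (fun _ => A) ω + G.indicator (fun _ => A) ω + B := by
    filter_upwards [htriv, hcompat, hR.est_lasso n hnmem, hR.greedy (n + 1) ht,
      hR.bounded (n + 1) ht, hopt.optimal (n + 1) ht] with ω h1 h2 h3 h4 h5 h6
    have hN0 : 0 ≤ N.indicator (fun _ => A) ω := Set.indicator_nonneg (fun _ _ => hA0) ω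
    have hG0 : 0 ≤ G.indicator (fun _ => A) ω := Set.indicator_nonneg (fun _ _ => hA0) ω
    by_cases hωN : ω ∈ N
    · rw [Set.indicator_of_mem hωN]
      linarith [(le_abs_self _).trans h1]
    by_cases hωG : ω ∈ G
    · rw [Set.indicator_of_mem hωG]
      linarith [(le_abs_self _).trans h1]
    have h7 := l1_est_sub_le hσ hx hL hS hφ hn1 (h2 n hnmem) (h3 β) hωN hωG
    have h8 : meanGap R β opt (n + 1) ω ≤ 2 * L * xmax * l1 (R.est n ω - β) :=
      h4.regret_le h5 h6.1
    have h9 : 2 * L * xmax * l1 (R.est n ω - β) ≤ B :=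
      mul_le_mul_of_nonneg_left h7 (by positivity)
    linarith
  have hint : ∫ ω, meanGap R β opt (n + 1) ω ∂μ ≤ A * (μ.real N + μ.real G) + B := by
    have iN : Integrable (N.indicator fun _ => A) μ := (integrable_const A).indicator hNm
    have iG : Integrable (G.indicator fun _ => A) μ := (integrable_const A).indicator hGm
    have iNG : Integrable
        (fun ω => N.indicator (fun _ => A) ω + G.indicator (fun _ => A) ω) μ := iN.add iG
    refine (integral_mono_ae (integrable_meanGap hR hopt ht)
      (iNG.add (integrable_const B)) hpt).trans_eq ?_
    rw [integral_add' iNG (integrable_const B), integral_add iN iG,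
      integral_indicator_const _ hNm, integral_indicator_const _ hGm]
    simp
    ring
  obtain ⟨-, -, hκ⟩ := sq_kappa_le (φ := φ) hx hS hφ
  have hNle : μ.real N ≤ 2 / (L : ℝ) ^ 2 * (1 / (n : ℝ) ^ 2) :=
    measure_noiseEvent_le hR hσ hx hL hd hnmem
  have hGle : μ.real G ≤ min 1 (2 * (d : ℝ) ^ 2 *
      Real.exp (-(8 * (kappa xmax (activeSet β).card φ) ^ 2 * n))) := by
    refine le_min measureReal_le_one ((measure_gramEvent_le hR hx hL hnmem (by positivity)).trans ?_)
    gcongr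
  have hlam : B ≤ 64 * L * xmax ^ 2 * σ * (activeSet β).card / φ ^ 2 *
      (√(4 * Real.log ((L : ℝ) * T) + 2 * Real.log d) / √L) * (1 / √(n : ℝ)) := by
    have hn0 : (0 : ℝ) < n := by exact_mod_cast hn1
    have hlog : Real.log (L * n) ≤ Real.log (L * T) :=
      Real.log_le_log (by positivity) (by gcongr)
    have hsqrt : √((4 * Real.log (L * n) + 2 * Real.log d) / (L * n))
        ≤ √(4 * Real.log ((L : ℝ) * T) + 2 * Real.log d) / √L * (1 / √(n : ℝ)) := by
      rw [Real.sqrt_div' _ (by positivity), Real.sqrt_mul hL0.le, div_mul_div_comm, mul_one]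
      gcongr
    calc B = 64 * L * xmax ^ 2 * σ * (activeSet β).card / φ ^ 2 *
          √((4 * Real.log (L * n) + 2 * Real.log d) / (L * n)) := by
          rw [hB, lassoLam]; ring
      _ ≤ 64 * L * xmax ^ 2 * σ * (activeSet β).card / φ ^ 2 *
          (√(4 * Real.log ((L : ℝ) * T) + 2 * Real.log d) / √L * (1 / √(n : ℝ))) := by gcongr
      _ = _ := by ring
  calc _ ≤ A * (μ.real N + μ.real G) + B := hint
    _ ≤ _ := add_le_add (mul_le_mul_of_nonneg_left (add_le_add hNle hGle) hA0) hlam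

/-! ### Cumulative regret -/

lemma sum_one_div_sqrt_range_le (T : ℕ) :
    ∑ n ∈ Finset.range T, 1 / √(n : ℝ) ≤ 2 * √(T : ℝ) := by
  cases T with
  | zero => simp
  | succ m =>
    rw [Finset.sum_range_succ']
    have h1 := sum_one_div_sqrt_le m
    have h2 : √(m : ℝ) ≤ √((m + 1 : ℕ) : ℝ) := Real.sqrt_le_sqrt (by push_cast; linarith)
    push_cast at h2 ⊢
    simp only [Real.sqrt_zero, div_zero, add_zero]
    linarith

/-- The sum over the rounds of the probability bounds for the Gram matrix.  The factor `8` in the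
exponent absorbs the number `2 d²` of tail events and the constant terms of the sum. -/
lemma sum_min_one_gram_le {κ : ℝ} (hκ : 0 < κ) (hκ' : κ ^ 2 ≤ 7 / 16) {d : ℕ} (hd : 1 ≤ d)
    (T : ℕ) :
    ∑ n ∈ Finset.range T, min 1 (2 * (d : ℝ) ^ 2 * Real.exp (-(8 * κ ^ 2 * n)))
      ≤ (1 + Real.log ((d : ℝ) * (d + 1))) / κ ^ 2 := by
  have hd1 : (1 : ℝ) ≤ d := by exact_mod_cast hd
  refine (sum_min_one_exp_le (by nlinarith) (by positivity) T).trans ?_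
  have hlog : Real.log (2 * (d : ℝ) ^ 2) ≤ 2 * Real.log ((d : ℝ) * (d + 1)) := by
    rw [← Nat.cast_two, ← Real.log_pow]
    refine Real.log_le_log (by positivity) ?_
    have : (2 : ℝ) ≤ (d + 1) ^ 2 := by nlinarith
    rw [mul_pow, mul_comm, Nat.cast_two]
    exact mul_le_mul_of_nonneg_left this (sq_nonneg _)
  have hlog0 : 0 ≤ Real.log ((d : ℝ) * (d + 1)) := Real.log_nonneg (by nlinarith)
  rw [le_div_iff₀ (by positivity)]
  have e : (Real.log (2 * (d : ℝ) ^ 2) / (8 * κ ^ 2) + 2 + 1 / (8 * κ ^ 2)) * κ ^ 2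
      = Real.log (2 * (d : ℝ) ^ 2) / 8 + 2 * κ ^ 2 + 1 / 8 := by
    field_simp
  rw [e]
  linarith

lemma xmax_nonneg [IsProbabilityMeasure μ] (hR : IsGreedyLassoRun μ xmax σ L T β R)
    (hT : 1 ≤ T) (hL : 1 ≤ L) (hS : 1 ≤ (activeSet β).card) : 0 ≤ xmax := by
  have ht : 1 ∈ Finset.Icc 1 T := Finset.mem_Icc.2 ⟨le_rfl, hT⟩
  obtain ⟨ω, hcard, hb⟩ := ((ae_card_sel hR ht).and (hR.bounded 1 ht)).exists
  obtain ⟨k, -⟩ := Finset.card_pos.1 (hcard ▸ hL : 0 < (R.sel 1 ω).card)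
  obtain ⟨i, -⟩ := Finset.card_pos.1 (hS : 0 < (activeSet β).card)
  exact (abs_nonneg _).trans (hb k i)

lemma regret_eq_sum_meanGap [IsProbabilityMeasure μ] (hR : IsGreedyLassoRun μ xmax σ L T β R)
    (hopt : IsOptimalSelection μ L T β R opt) :
    R.regret μ β opt T = ∑ n ∈ Finset.range T, ∫ ω, meanGap R β opt (n + 1) ω ∂μ := by
  rw [Run.regret, Finset.sum_congr rfl fun t ht => integral_reward_sub_eq hR hopt ht,
    Finset.range_eq_Ico, Finset.sum_Ico_add' (fun t => ∫ ω, meanGap R β opt t ω ∂μ) 0 T 1]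
  rfl

theorem regret_le [IsProbabilityMeasure μ] {b φ : ℝ} {s₀ : ℕ} (hσ : 0 < σ) (hs₀ : 1 ≤ s₀)
    (hL : 1 ≤ L) (hT : 1 ≤ T) (hφ : 0 < φ) (hS : (activeSet β).card = s₀) (hb : l1 β ≤ b)
    (hR : IsGreedyLassoRun μ xmax σ L T β R) (hopt : IsOptimalSelection μ L T β R opt)
    (hcompat : ∀ᵐ ω ∂μ, ∀ t ∈ Finset.Icc 1 T,
      φ < compatConst (activeSet β) (R.expectedGram μ β L t ω)) :
    R.regret μ β opt T ≤
      2 * L * xmax * b *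
          ((1 + Real.log ((d : ℝ) * (d + 1))) / (kappa xmax s₀ φ) ^ 2
            + Real.pi ^ 2 / (3 * (L : ℝ) ^ 2))
        + 128 * s₀ * xmax ^ 2 * σ / φ ^ 2
          * √(L * (4 * Real.log ((L : ℝ) * T) + 2 * Real.log d) * T) := by
  subst hS
  have hl1 : 0 ≤ l1 β := Finset.sum_nonneg fun _ _ => abs_nonneg _
  have hL0 : (0 : ℝ) < L := by exact_mod_cast hL
  have hd : 1 ≤ d := hs₀.trans (by simpa using Finset.card_le_univ (activeSet β))
  rw [regret_eq_sum_meanGap hR hopt]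
  rcases (xmax_nonneg hR hT hL hs₀).eq_or_lt with hx | hx
  · -- without features there is no regret
    subst hx
    have h0 : ∀ n ∈ Finset.range T, ∫ ω, meanGap R β opt (n + 1) ω ∂μ = 0 := fun n hn => by
      refine integral_eq_zero_of_ae ?_
      filter_upwards [ae_abs_meanGap_le hR hopt
        (Finset.mem_Icc.2 ⟨by omega, Finset.mem_range.1 hn⟩)] with ω hω
      simpa using hω
    rw [Finset.sum_eq_zero h0]
    simp
  obtain ⟨hκ, hκ', -⟩ := sq_kappa_le (φ := φ) hx hs₀ hφ
  have hzeta : ∑ n ∈ Finset.range T, 1 / (n : ℝ) ^ 2 ≤ Real.pi ^ 2 / 6 :=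
    sum_le_hasSum _ (fun n _ => by positivity) hasSum_zeta_two
  have hprob : ∑ n ∈ Finset.range T, (2 / (L : ℝ) ^ 2 * (1 / (n : ℝ) ^ 2) + min 1
      (2 * (d : ℝ) ^ 2 * Real.exp (-(8 * (kappa xmax (activeSet β).card φ) ^ 2 * n))))
      ≤ (1 + Real.log ((d : ℝ) * (d + 1))) / (kappa xmax (activeSet β).card φ) ^ 2
            + Real.pi ^ 2 / (3 * (L : ℝ) ^ 2) := by
    rw [Finset.sum_add_distrib, ← Finset.mul_sum, add_comm]
    refine add_le_add (sum_min_one_gram_le hκ hκ' hd T) ?_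
    calc 2 / (L : ℝ) ^ 2 * ∑ n ∈ Finset.range T, 1 / (n : ℝ) ^ 2
        ≤ 2 / (L : ℝ) ^ 2 * (Real.pi ^ 2 / 6) := by gcongr
      _ = _ := by field_simp; norm_num
  have hlogLT : 0 ≤ Real.log ((L : ℝ) * T) :=
    Real.log_nonneg (by exact_mod_cast Nat.mul_pos hL hT)
  have hlogd : 0 ≤ Real.log d := Real.log_nonneg (by exact_mod_cast hd)
  set q := 4 * Real.log ((L : ℝ) * T) + 2 * Real.log d with hq
  have hq0 : 0 ≤ q := by positivity
  have hfin : 64 * L * xmax ^ 2 * σ * (activeSet β).card / φ ^ 2 * (√q / √L) * (2 * √(T : ℝ))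
      = 128 * (activeSet β).card * xmax ^ 2 * σ / φ ^ 2 * √(L * q * T) := by
    rw [Real.sqrt_mul (by positivity), Real.sqrt_mul hL0.le]
    have : (L : ℝ) / √L = √L := Real.div_sqrt
    calc _ = 128 * (activeSet β).card * xmax ^ 2 * σ / φ ^ 2 * ((L / √L) * √q * √(T : ℝ)) := by
          ring
      _ = _ := by rw [this]
  calc _ ≤ ∑ n ∈ Finset.range T, (2 * L * xmax * l1 β *
          (2 / (L : ℝ) ^ 2 * (1 / (n : ℝ) ^ 2) + min 1 (2 * (d : ℝ) ^ 2 *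
            Real.exp (-(8 * (kappa xmax (activeSet β).card φ) ^ 2 * n))))
        + 64 * L * xmax ^ 2 * σ * (activeSet β).card / φ ^ 2 * (√q / √L) * (1 / √(n : ℝ))) :=
        Finset.sum_le_sum fun n hn => integral_meanGap_succ_le hR hopt hσ hx hL hs₀ hφ hcompat
          (Finset.mem_range.1 hn)
    _ ≤ _ := by
        rw [Finset.sum_add_distrib, ← Finset.mul_sum, ← Finset.mul_sum, ← hfin]
        refine add_le_add ?_ ?_
        · refine mul_le_mul ?_ hprob (Finset.sum_nonneg fun n _ => ?_)
            (mul_nonneg (by positivity) (hl1.trans hb))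
          · exact mul_le_mul_of_nonneg_left hb (by positivity)
          · exact add_nonneg (by positivity) (le_min zero_le_one (by positivity))
        · exact mul_le_mul_of_nonneg_left (sum_one_div_sqrt_range_le T) (by positivity)

/-- For large horizons the explicit bound is of order `φ⁻² √(T log (d T))`: the first summand does
not depend on `T`, and `log (L T) ≤ 2 log T` for `T ≥ L`. -/
lemma exists_forall_bound_le_rate {L s₀ d : ℕ} {σ φ : ℝ} (hσ : 0 < σ) (xmax A : ℝ) (hL : 1 ≤ L)
    (hd : 1 ≤ d) (hφ : 0 < φ) :
    ∃ T₁ : ℕ, 1 ≤ T₁ ∧ ∀ T : ℕ, T₁ ≤ T →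
      A + 128 * s₀ * xmax ^ 2 * σ / φ ^ 2
          * √(L * (4 * Real.log ((L : ℝ) * T) + 2 * Real.log d) * T)
        ≤ (1 + 128 * s₀ * xmax ^ 2 * σ * √(8 * L)) / φ ^ 2 * √(T * Real.log ((d : ℝ) * T)) := by
  refine ⟨max (max L 3) ⌈(A * φ ^ 2) ^ 2⌉₊, by omega, fun T hT => ?_⟩
  have hTL : L ≤ T := (le_max_left _ _).trans ((le_max_left _ _).trans hT)
  have hT3 : 3 ≤ T := (le_max_right _ _).trans ((le_max_left _ _).trans hT)
  have hTA : (A * φ ^ 2) ^ 2 ≤ T :=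
    (Nat.le_ceil _).trans (by exact_mod_cast (le_max_right _ _).trans hT)
  have hL1 : (1 : ℝ) ≤ L := by exact_mod_cast hL
  have hd1 : (1 : ℝ) ≤ d := by exact_mod_cast hd
  have hT3' : (3 : ℝ) ≤ T := by exact_mod_cast hT3
  have hTL' : (L : ℝ) ≤ T := by exact_mod_cast hTL
  have hlogd : 0 ≤ Real.log d := Real.log_nonneg hd1
  have hdT : Real.log ((d : ℝ) * T) = Real.log d + Real.log T :=
    Real.log_mul (by positivity) (by positivity)
  have hLT : Real.log ((L : ℝ) * T) = Real.log L + Real.log T :=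
    Real.log_mul (by positivity) (by positivity)
  have hlogL : Real.log L ≤ Real.log T := Real.log_le_log (by positivity) hTL'
  have hlogT : 1 ≤ Real.log T := by
    rw [Real.le_log_iff_exp_le (by positivity)]
    linarith [Real.exp_one_lt_d9]
  set r := √(T * Real.log ((d : ℝ) * T)) with hr
  have h1 : A ≤ 1 / φ ^ 2 * r := by
    have h2 : A * φ ^ 2 ≤ r := by
      refine (Real.le_sqrt_of_sq_le hTA).trans (Real.sqrt_le_sqrt ?_)
      rw [hdT]
      nlinarith
    rw [one_div_mul_eq_div, le_div_iff₀ (by positivity)]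
    exact h2
  have h3 : √(L * (4 * Real.log ((L : ℝ) * T) + 2 * Real.log d) * T) ≤ √(8 * L) * r := by
    rw [hr, ← Real.sqrt_mul (by positivity)]
    refine Real.sqrt_le_sqrt ?_
    rw [hdT, hLT]
    have h4 : 4 * (Real.log L + Real.log T) + 2 * Real.log d ≤ 8 * (Real.log d + Real.log T) := by
      linarith
    calc _ ≤ L * (8 * (Real.log d + Real.log T)) * T := by gcongr
      _ = _ := by ring
  calc _ ≤ 1 / φ ^ 2 * r + 128 * s₀ * xmax ^ 2 * σ / φ ^ 2 * (√(8 * L) * r) := by gcongr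
    _ = _ := by ring

end GreedyRun

end SparseBandit

theorem corollary2 (xmax b σ : ℝ) (s₀ L : ℕ) (hσ : 0 < σ) (hs₀ : 1 ≤ s₀) (hL : 1 ≤ L) :
    -- the explicit bound, for every horizon
    (∀ (K d T : ℕ) (φ : ℝ) (β : Fin d → ℝ) (Ω : Type*) [MeasurableSpace Ω] (μ : Measure Ω)
        [IsProbabilityMeasure μ] (R : SparseBandit.Run Ω K d) (opt : ℕ → Ω → Finset (Fin K)),
      1 ≤ T → 0 < φ →
      (SparseBandit.activeSet β).card = s₀ → SparseBandit.l1 β ≤ b →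
      SparseBandit.IsGreedyLassoRun μ xmax σ L T β R →
      SparseBandit.IsOptimalSelection μ L T β R opt →
      (∀ᵐ ω ∂μ, ∀ t ∈ Finset.Icc 1 T,
        φ < SparseBandit.compatConst (SparseBandit.activeSet β) (R.expectedGram μ β L t ω)) →
      R.regret μ β opt T ≤
        2 * L * xmax * b *
            ((1 + Real.log ((d : ℝ) * (d + 1))) / (SparseBandit.kappa xmax s₀ φ) ^ 2
              + Real.pi ^ 2 / (3 * (L : ℝ) ^ 2))
          + 128 * s₀ * xmax ^ 2 * σ / φ ^ 2
            * √(L * (4 * Real.log ((L : ℝ) * T) + 2 * Real.log d) * T)) ∧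
    -- the rate: the constant `C` depends on `xmax, b, σ, s₀, L` only
    (∃ C : ℝ, 0 < C ∧ ∀ (d : ℕ) (φ : ℝ), 0 < φ → ∃ T₁ : ℕ, ∀ T : ℕ, T₁ ≤ T →
      ∀ (K : ℕ) (β : Fin d → ℝ) (Ω : Type*) [MeasurableSpace Ω] (μ : Measure Ω)
        [IsProbabilityMeasure μ] (R : SparseBandit.Run Ω K d) (opt : ℕ → Ω → Finset (Fin K)),
      (SparseBandit.activeSet β).card = s₀ → SparseBandit.l1 β ≤ b →
      SparseBandit.IsGreedyLassoRun μ xmax σ L T β R →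
      SparseBandit.IsOptimalSelection μ L T β R opt →
      (∀ᵐ ω ∂μ, ∀ t ∈ Finset.Icc 1 T,
        φ < SparseBandit.compatConst (SparseBandit.activeSet β) (R.expectedGram μ β L t ω)) →
      R.regret μ β opt T ≤ C / φ ^ 2 * √(T * Real.log ((d : ℝ) * T))) := by
  refine ⟨fun K d T φ β Ω _ μ _ R opt hT hφ hS hb hR hopt hcompat =>
    SparseBandit.regret_le hσ hs₀ hL hT hφ hS hb hR hopt hcompat,
    1 + 128 * s₀ * xmax ^ 2 * σ * √(8 * L), by positivity, fun d φ hφ => ?_⟩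
  rcases Nat.eq_zero_or_pos d with rfl | hd
  · -- in dimension zero no parameter has a nonempty support
    refine ⟨0, fun T _ K β Ω _ μ _ R opt hS => ?_⟩
    have := Finset.card_le_univ (SparseBandit.activeSet β)
    simp only [Fintype.card_fin] at this
    omega
  obtain ⟨T₁, hT₁, hrate⟩ := SparseBandit.exists_forall_bound_le_rate (s₀ := s₀) hσ xmax
    (2 * L * xmax * b *
      ((1 + Real.log ((d : ℝ) * (d + 1))) / (SparseBandit.kappa xmax s₀ φ) ^ 2
        + Real.pi ^ 2 / (3 * (L : ℝ) ^ 2))) hL hd hφ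
  exact ⟨T₁, fun T hT K β Ω _ μ _ R opt hS hb hR hopt hcompat =>
    (SparseBandit.regret_le hσ hs₀ hL (hT₁.trans hT) hφ hS hb hR hopt hcompat).trans (hrate T hT)⟩
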